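/- Let $\|\cdot\|$ be a norm on $\mathbb{R}^2$. For $x\in\mathbb{R}^2$ put $\langle x\rangle=\min\{\|x-p\| : p\in\mathbb{Z}^2\}$. For $v\in\mathbb{R}^2\setminus\mathbb{Q}^2$ let $(q_n,p_n)_{n\ge 0}\subset\mathbb{N}\times\mathbb{Z}^2$ be a best approximation sequence of $v$: $q_0=1$, $q_{n+1}=\min\{q\ge 1: \langle qv\rangle<\langle q_nv\rangle\}$, so that $q_0<q_1<\cdots$, and $\|q_nv-p_n\|=\langle q_nv\rangle$. Put $\beta_n(v)=\sqrt{q_{n+1}}\,(q_nv-p_n)$. Define $$\mathbb{D}_{2,\|\cdot\|}=\Bigl\{\limsup_{T\to\infty}T^{1/2}\min_{1\le q\le T}\langle qv\rangle : v\in\mathbb{R}^2\setminus\mathbb{Q}^2\Bigr\},$$ $$\mathbb{D}^{\lim}_{2,\|\cdot\|}=\Bigl\{\lim_{n\to\infty}\|\beta_n(v)\| : v\in\mathbb{R}^2\setminus\mathbb{Q}^2\text{ for which this limit exists}\Bigr\}.$$ Let $\gamma_{\|\cdot\|}$ be the minimal constant $C>0$ such that for all sufficiently large $T$ and all $v\in\mathbb{R}^2\setminus\mathbb{Q}^2$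 there is an integer $1\le q\le T$ with $T^{1/2}\langle qv\rangle\le C$. Call $\sqrt{au_1^2+cu_2^2}$, with $a,c>0$, a best ellipsoid norm for $\|\cdot\|$ with parameters $a,c,D$, where $D\ge 1$, if $$\sqrt{au_1^2+cu_2^2}\le\|u\|\le D\sqrt{au_1^2+cu_2^2}\qquad\text{for all }u\in\mathbb{R}^2,$$ and $(a,c,D)$ maximises $\left(\frac{4ac}{4D^2-1}\right)^{1/4}$ among all triples with this property. (i) For every norm on $\mathbb{R}^2$ a best ellipsoid norm exists, and with $M_{\|\cdot\|}=\left(\frac{4ac}{4D^2-1}\right)^{1/4}>0$ for the parameters $a,c,D$ of any best ellipsoid norm, $$[0,M_{\|\cdot\|}]\subseteq\mathbb{D}^{\lim}_{2,\|\cdot\|}\subseteq\mathbb{D}_{2,\|\cdot\|}.$$ (ii) If $\|(x,y)\|=\sqrt{ax^2+cy^2}$ with $a,c>0$, then $a,c,1$ are parameters of a best ellipsoid norm, the constant $\gamma_{\|\cdot\|}$ exists, $M_{\|\cdot\|}=\gamma_{\|\cdot\|}$ and $\mathbb{D}_{2,\|\cdot\|}=[0,\gamma_{\|\cdot\|}]$;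 moreover $M_{\|\cdot\|}$ is best possible: $[0,M']\subseteq\mathbb{D}_{2,\|\cdot\|}$ implies $M'\le M_{\|\cdot\|}$. (iii) In particular, best ellipsoid parameters and $M_{\|\cdot\|}$ are: for the Euclidean norm $a=c=1$, $D=1$, $M_{\|\cdot\|}=\sqrt{2/\sqrt3}$; for the maximum norm $a=c=\frac12$, $D=\sqrt2$, $M_{\|\cdot\|}=7^{-1/4}$; for the $p$-norm with real $p>2$, $a=c=2^{\frac2p-1}$, $D=2^{\frac12-\frac1p}$, $M_{\|\cdot\|}=8^{\frac1{2p}}(8-4^{\frac1p})^{-\frac14}$; for the $p$-norm with $1\le p<2$, $a=c=1$, $D=2^{\frac1p-\frac12}$, $M_{\|\cdot\|}=\sqrt2\,(2^{1+\frac2p}-1)^{-\frac14}$. -/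

import Mathlib

open Set Filter Topology

noncomputable section

/-- The embedding of the integer lattice `ℤ^d` in `ℝ^d`. -/
def intVec {d : ℕ} (p : Fin d → ℤ) : Fin d → ℝ := fun i => (p i : ℝ)

/-- `v ∈ ℝ^d ∖ ℚ^d`: not all coordinates of `v` are rational. -/
def NotRationalVec {d : ℕ} (v : Fin d → ℝ) : Prop :=
  ¬ ∃ r : Fin d → ℚ, v = fun i => (r i : ℝ)

/-- `⟨v⟩ = min {‖v - p‖ : p ∈ ℤ^d}`, for the norm `N`. -/
def latticeDist {d : ℕ} (N : Seminorm ℝ (Fin d → ℝ)) (v : Fin d → ℝ) : ℝ :=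
  ⨅ p : Fin d → ℤ, N (v - intVec p)

/-- `T^{1/d} · min_{1 ≤ q ≤ T} ⟨q v⟩` (meaningful for `T ≥ 1`). -/
def dirichletFun {d : ℕ} (N : Seminorm ℝ (Fin d → ℝ)) (v : Fin d → ℝ) (T : ℝ) : ℝ :=
  T ^ (1 / (d : ℝ)) *
    sInf ((fun q : ℕ => latticeDist N ((q : ℝ) • v)) '' {q : ℕ | 1 ≤ q ∧ (q : ℝ) ≤ T})

/-- The Dirichlet spectrum. The upper limit is taken in `[-∞, ∞]`. -/
def dirichletSpectrum {d : ℕ} (N : Seminorm ℝ (Fin d → ℝ)) : Set ℝ :=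
  {s : ℝ | ∃ v : Fin d → ℝ, NotRationalVec v ∧
    limsup (fun T : ℝ => ((dirichletFun N v T : ℝ) : EReal)) atTop = (s : EReal)}

/-- `(q_n, p_n)` is a best approximation vectors sequence of `v` with respect to `N`. -/
structure IsBestApproxSeq {d : ℕ} (N : Seminorm ℝ (Fin d → ℝ)) (v : Fin d → ℝ)
    (q : ℕ → ℕ) (p : ℕ → Fin d → ℤ) : Prop where
  q_zero : q 0 = 1
  strictMono : StrictMono q
  isLeast : ∀ n, IsLeast
    {k : ℕ | 1 ≤ k ∧ latticeDist N ((k : ℝ) • v) < latticeDist N ((q n : ℝ) • v)} (q (n + 1))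
  realises : ∀ n, latticeDist N ((q n : ℝ) • v) = N ((q n : ℝ) • v - intVec (p n))

/-- The `n`-th long displacement vector `q_{n+1}^{1/d} (q_n v - p_n)`. -/
def longDisplacement {d : ℕ} (v : Fin d → ℝ) (q : ℕ → ℕ) (p : ℕ → Fin d → ℤ) (n : ℕ) :
    Fin d → ℝ :=
  ((q (n + 1) : ℝ) ^ (1 / (d : ℝ))) • ((q n : ℝ) • v - intVec (p n))

/-- The limiting Dirichlet spectrum. -/
def limitingDirichletSpectrum {d : ℕ} (N : Seminorm ℝ (Fin d → ℝ)) : Set ℝ :=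
  {s : ℝ | ∃ v : Fin d → ℝ, NotRationalVec v ∧ ∃ (q : ℕ → ℕ) (p : ℕ → Fin d → ℤ),
    IsBestApproxSeq N v q p ∧
      Tendsto (fun n => N (longDisplacement v q p n)) atTop (𝓝 s)}

/-- The positive constants `C` with which the Dirichlet theorem for `N` holds: for all
sufficiently large `T`, every `v ∈ ℝ^d ∖ ℚ^d` has a `1 ≤ q ≤ T` with `T^{1/d} ⟨q v⟩ ≤ C`. -/
def dirichletConstants {d : ℕ} (N : Seminorm ℝ (Fin d → ℝ)) : Set ℝ :=
  {C : ℝ | 0 < C ∧ ∃ T₀ : ℝ, ∀ T : ℝ, T₀ ≤ T → ∀ v : Fin d → ℝ, NotRationalVec v →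
    ∃ q : ℕ, 1 ≤ q ∧ (q : ℝ) ≤ T ∧
      T ^ (1 / (d : ℝ)) * latticeDist N ((q : ℝ) • v) ≤ C}

/-- The diagonal ellipse norm `√(a u₁² + c u₂²)`. -/
def ellipseNorm (a c : ℝ) (u : Fin 2 → ℝ) : ℝ := √(a * u 0 ^ 2 + c * u 1 ^ 2)

/-- `‖u‖_@ ≤ ‖u‖ ≤ D ‖u‖_@` for all `u`, where `‖·‖_@` is the ellipse norm of `a, c`. -/
def IsEllipsoidNormFor (N : Seminorm ℝ (Fin 2 → ℝ)) (a c D : ℝ) : Prop :=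
  0 < a ∧ 0 < c ∧ 1 ≤ D ∧ ∀ u, ellipseNorm a c u ≤ N u ∧ N u ≤ D * ellipseNorm a c u

/-- The value `(4ac / (4D² - 1))^{1/4}`. -/
def ellipsoidValue (a c D : ℝ) : ℝ := (4 * a * c / (4 * D ^ 2 - 1)) ^ (1 / 4 : ℝ)

/-- The ellipse norm of `a, c` is a best ellipsoid norm for `N`, with parameters `a, c, D`. -/
def IsBestEllipsoidNormFor (N : Seminorm ℝ (Fin 2 → ℝ)) (a c D : ℝ) : Prop :=
  IsEllipsoidNormFor N a c D ∧
    ∀ a' c' D' : ℝ, IsEllipsoidNormFor N a' c' D' →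
      ellipsoidValue a' c' D' ≤ ellipsoidValue a c D

/-- The ellipse norm of `a, c` is a best ellipsoid norm for `N`, with parameters `a, c, D` and
value `M`, and `[0, M]` lies in both spectra. -/
def HasBestEllipsoidSegment (N : Seminorm ℝ (Fin 2 → ℝ)) (a c D M : ℝ) : Prop :=
  IsBestEllipsoidNormFor N a c D ∧ ellipsoidValue a c D = M ∧
    Icc 0 M ⊆ limitingDirichletSpectrum N ∧ limitingDirichletSpectrum N ⊆ dirichletSpectrum N

end

/-!
The long displacement of a best approximation `(q, p)` of `v`, followed by a best approximation of
denominator `q'`, is `√q' (q v - p)`. If `v` is very close to `p' / q'`, then `q v - p` is close to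
a shortest vector of the planar lattice obtained by projecting `ℤ³` along `(q', p')`, which has
determinant `1 / q'`. So it has to be seen which shortest vectors can be prescribed for such
projections along a sequence of rational points.

For the lower bound, a basis `e, g, f` of `ℤ³` is replaced by `f + m g + k e, e, g` with `m` large
and `k` of order `m²`. The leading term of `k` fixes the normalised length `s` of the projection
`x` of `e`; a correction of order `m` to `k` makes the projection `x'` of `g` satisfy
`⟨x', x⟩ ≈ ⟨x, x⟩ / 2` modulo `⟨x, x⟩`, in the inner product of the ellipse norm
(`exists_coefficients`). By Lagrange's identity the vectors on the two lattice lines next to that of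
`x` then have squared ellipse norm at least about `|x|² / 4 + ac / |x|²` in normalised units. This
exceeds `D² |x|²` exactly when `|x|⁴ < 4ac / (4D² - 1)`, and then the vectors further off are long
enough as well, so `x` is the shortest vector also for the given norm
(`IsEllipsoidNormFor.lt_of_projection_near_half`). All conditions are open in `v`, and nested
balls around the rational points yield a `v` with prescribed limit
(`Icc_subset_limitingDirichletSpectrum`). The vector `(q', p') - (q, p)` projects to `-x` and may
be a further best approximation, but its denominator is asymptotic to `q'`, so the limit is not
affected.

For an ellipse norm, the upper bound is Thue's theorem on the torus `ℝ² / ℤ²`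
(`card_mul_sq_le`): if `⟨k v⟩ ≥ r` for `1 ≤ k ≤ T`, the `⌊T⌋ + 1` points `0, v, …, ⌊T⌋ v` are
separated by `r`, and their Voronoi cells, even cut off at distance `r / √3`, have at least the
area of a regular hexagon of inradius `r / 2`: the pieces of the disc that neighbours cut off lie
in disjoint sectors, and each takes at most the fraction `1 - 3√3 / (2π)` of its sector
(`le_volume_voronoi`).

Best ellipsoid norms exist by compactness, and in the examples the values of the norm at `(1, 0)`,
`(0, 1)`, `(1, 1)` already determine the optimal parameters.
-/

/-! ### Norms on `ℝ^d` and the distance to the integer lattice -/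

section Basics

variable {d : ℕ} {N : Seminorm ℝ (Fin d → ℝ)}

lemma seminorm_le_mul_norm (N : Seminorm ℝ (Fin d → ℝ)) :
    ∃ K : ℝ, 0 < K ∧ ∀ u, N u ≤ K * ‖u‖ := by
  refine ⟨∑ i, N (Pi.single i 1) + 1, by positivity, fun u => ?_⟩
  have hu : u = ∑ i, u i • (Pi.single i 1 : Fin d → ℝ) := by
    ext j
    simp [Finset.sum_apply, Pi.single_apply]
  have h1 : N u ≤ ∑ i, N (u i • (Pi.single i 1 : Fin d → ℝ)) := by
    conv_lhs => rw [hu]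
    exact Finset.le_sum_of_subadditive N (map_zero N).le (map_add_le_add N) _ _
  have h2 : ∑ i, N (u i • (Pi.single i 1 : Fin d → ℝ)) ≤ ∑ i, ‖u‖ * N (Pi.single i 1) := by
    refine Finset.sum_le_sum fun i _ => ?_
    rw [map_smul_eq_mul]
    exact mul_le_mul_of_nonneg_right (norm_le_pi_norm u i) (apply_nonneg N _)
  rw [← Finset.mul_sum] at h2
  nlinarith [norm_nonneg u]

lemma seminorm_abs_sub_le (N : Seminorm ℝ (Fin d → ℝ)) (x y : Fin d → ℝ) :
    |N x - N y| ≤ N (x - y) := by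
  rw [abs_le]
  constructor
  · have := map_sub_le_add N (x - y) x
    have h2 : N y ≤ N (x - y) + N x := by
      have := map_sub_le_add N x (x - y)
      rw [sub_sub_cancel] at this
      linarith
    linarith
  · have := map_add_le_add N (x - y) y
    rw [sub_add_cancel] at this
    linarith

lemma seminorm_continuous (N : Seminorm ℝ (Fin d → ℝ)) : Continuous N := by
  obtain ⟨K, hK, h⟩ := seminorm_le_mul_norm N
  refine (LipschitzWith.of_dist_le_mul (K := K.toNNReal) fun x y => ?_).continuous
  rw [Real.dist_eq, Real.coe_toNNReal _ hK.le, dist_eq_norm]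
  exact (seminorm_abs_sub_le N x y).trans (h _)

lemma seminorm_pos (hN : ∀ x, N x = 0 → x = 0) {x : Fin d → ℝ} (hx : x ≠ 0) : 0 < N x :=
  lt_of_le_of_ne (apply_nonneg N x) fun h => hx (hN x h.symm)

lemma exists_mul_norm_le_seminorm (hN : ∀ x, N x = 0 → x = 0) :
    ∃ κ : ℝ, 0 < κ ∧ ∀ u, κ * ‖u‖ ≤ N u := by
  rcases (Metric.sphere (0 : Fin d → ℝ) 1).eq_empty_or_nonempty with he | hne
  · refine ⟨1, one_pos, fun u => ?_⟩
    by_cases hu : u = 0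
    · simp [hu]
    · exfalso
      have : (‖u‖⁻¹ • u) ∈ Metric.sphere (0 : Fin d → ℝ) 1 := by
        simp [norm_smul, inv_mul_cancel₀ (norm_ne_zero_iff.2 hu)]
      rw [he] at this
      exact this
  · obtain ⟨x, hx, hmin⟩ := (isCompact_sphere (0 : Fin d → ℝ) 1).exists_isMinOn hne
      (seminorm_continuous N).continuousOn
    have hx1 : ‖x‖ = 1 := by simpa using hx
    have hx0 : x ≠ 0 := by
      rintro rfl
      simp at hx1
    refine ⟨N x, seminorm_pos hN hx0, fun u => ?_⟩
    by_cases hu : u = 0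
    · simp [hu]
    have hun : 0 < ‖u‖ := norm_pos_iff.2 hu
    have h1 : N x ≤ N (‖u‖⁻¹ • u) := hmin (by
      simp [norm_smul, inv_mul_cancel₀ (norm_ne_zero_iff.2 hu)])
    rw [map_smul_eq_mul, norm_inv, norm_norm, ← div_eq_inv_mul, le_div_iff₀ hun] at h1
    exact h1

lemma bddBelow_latticeDist (N : Seminorm ℝ (Fin d → ℝ)) (x : Fin d → ℝ) :
    BddBelow (range fun p : Fin d → ℤ => N (x - intVec p)) :=
  ⟨0, by rintro _ ⟨p, rfl⟩; exact apply_nonneg N _⟩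

lemma latticeDist_le (N : Seminorm ℝ (Fin d → ℝ)) (x : Fin d → ℝ) (p : Fin d → ℤ) :
    latticeDist N x ≤ N (x - intVec p) :=
  ciInf_le (bddBelow_latticeDist N x) p

lemma latticeDist_nonneg (N : Seminorm ℝ (Fin d → ℝ)) (x : Fin d → ℝ) :
    0 ≤ latticeDist N x :=
  le_ciInf fun _ => apply_nonneg N _

lemma latticeDist_le_add (N : Seminorm ℝ (Fin d → ℝ)) (x y : Fin d → ℝ) :
    latticeDist N x ≤ latticeDist N y + N (x - y) := by
  rw [← sub_le_iff_le_add]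
  refine le_ciInf fun p => ?_
  have h := map_add_le_add N (x - y) (y - intVec p)
  rw [sub_add_sub_cancel] at h
  linarith [latticeDist_le N x p]

lemma latticeDist_continuous (N : Seminorm ℝ (Fin d → ℝ)) : Continuous (latticeDist N) := by
  obtain ⟨K, hK, h⟩ := seminorm_le_mul_norm N
  refine (LipschitzWith.of_dist_le_mul (K := K.toNNReal) fun x y => ?_).continuous
  rw [Real.dist_eq, Real.coe_toNNReal _ hK.le, dist_eq_norm]
  refine le_trans ?_ (h _)
  rw [abs_le]
  have h1 := latticeDist_le_add N x y
  have h2 := latticeDist_le_add N y x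
  rw [map_sub_rev] at h2
  constructor <;> linarith

/-- The infimum defining the distance to the lattice is attained. -/
lemma exists_latticeDist_eq (hN : ∀ x, N x = 0 → x = 0) (x : Fin d → ℝ) :
    ∃ p : Fin d → ℤ, latticeDist N x = N (x - intVec p) := by
  obtain ⟨κ, hκ, hle⟩ := exists_mul_norm_le_seminorm hN
  set ρ := (N (x - intVec 0) + 1) / κ with hρ
  -- only the lattice points in a bounded box compete with the origin
  have hfin : {p : Fin d → ℤ | N (x - intVec p) ≤ N (x - intVec 0)}.Finite := by
    refine (Set.Finite.pi (t := fun i : Fin d => Icc ⌈x i - ρ⌉ ⌊x i + ρ⌋)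
      fun i => Set.finite_Icc _ _).subset fun p hp i _ => ?_
    have h1 : ‖x - intVec p‖ ≤ ρ := by
      rw [hρ, le_div_iff₀ hκ, mul_comm]
      exact (hle _).trans (le_trans hp (by linarith))
    have h2 := (norm_le_pi_norm (x - intVec p) i).trans h1
    simp only [Pi.sub_apply, intVec, Real.norm_eq_abs, abs_le] at h2
    exact ⟨Int.ceil_le.2 (by linarith), Int.le_floor.2 (by linarith)⟩
  obtain ⟨p, hp, hmin⟩ := Set.exists_min_image _ (fun p => N (x - intVec p)) hfin
    ⟨0, show N (x - intVec 0) ≤ N (x - intVec 0) from le_rfl⟩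
  refine ⟨p, le_antisymm (latticeDist_le N x p) (le_ciInf fun p' => ?_)⟩
  by_cases h : N (x - intVec p') ≤ N (x - intVec 0)
  · exact hmin p' h
  · exact le_trans hp (not_le.1 h).le

lemma lt_latticeDist_iff (hN : ∀ x, N x = 0 → x = 0) {x : Fin d → ℝ} {r : ℝ} :
    r < latticeDist N x ↔ ∀ p : Fin d → ℤ, r < N (x - intVec p) := by
  constructor
  · exact fun h p => h.trans_le (latticeDist_le N x p)
  · intro h
    obtain ⟨p, hp⟩ := exists_latticeDist_eq hN x
    rw [hp]
    exact h p

/-! ### Best approximations and the inclusion of the spectra -/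

lemma IsBestApproxSeq.one_le {v : Fin d → ℝ} {q : ℕ → ℕ} {p : ℕ → Fin d → ℤ}
    (h : IsBestApproxSeq N v q p) (n : ℕ) : 1 ≤ q n := by
  rw [← h.q_zero]
  exact h.strictMono.monotone (Nat.zero_le n)

lemma IsBestApproxSeq.latticeDist_le {v : Fin d → ℝ} {q : ℕ → ℕ} {p : ℕ → Fin d → ℤ}
    (h : IsBestApproxSeq N v q p) (n : ℕ) {k : ℕ} (hk : 1 ≤ k) (hkn : k < q (n + 1)) :
    latticeDist N ((q n : ℝ) • v) ≤ latticeDist N ((k : ℝ) • v) := by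
  by_contra! hlt
  exact absurd ((h.isLeast n).2 ⟨hk, hlt⟩) (not_le.2 hkn)

lemma IsBestApproxSeq.latticeDist_lt {v : Fin d → ℝ} {q : ℕ → ℕ} {p : ℕ → Fin d → ℤ}
    (h : IsBestApproxSeq N v q p) (n : ℕ) :
    latticeDist N ((q (n + 1) : ℝ) • v) < latticeDist N ((q n : ℝ) • v) :=
  (h.isLeast n).1.2

lemma IsBestApproxSeq.seminorm_longDisplacement {v : Fin d → ℝ} {q : ℕ → ℕ}
    {p : ℕ → Fin d → ℤ} (h : IsBestApproxSeq N v q p) (n : ℕ) :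
    N (longDisplacement v q p n) =
      (q (n + 1) : ℝ) ^ (1 / (d : ℝ)) * latticeDist N ((q n : ℝ) • v) := by
  rw [longDisplacement, map_smul_eq_mul, h.realises n, Real.norm_of_nonneg (by positivity)]

/-- A best approximation sequence exists as soon as no multiple of `v` is closest to the
lattice. -/
lemma exists_isBestApproxSeq (hN : ∀ x, N x = 0 → x = 0) (v : Fin d → ℝ)
    (hv : ∀ k : ℕ, 1 ≤ k → ∃ k' : ℕ, 1 ≤ k' ∧
      latticeDist N ((k' : ℝ) • v) < latticeDist N ((k : ℝ) • v)) :
    ∃ (q : ℕ → ℕ) (p : ℕ → Fin d → ℤ), IsBestApproxSeq N v q p := by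
  have hl : ∀ k : {k : ℕ // 1 ≤ k}, ∃ k' : {k : ℕ // 1 ≤ k}, IsLeast
      {j : ℕ | 1 ≤ j ∧ latticeDist N ((j : ℝ) • v) < latticeDist N ((k.1 : ℝ) • v)} k'.1 := by
    rintro ⟨k, hk⟩
    have hmem := Nat.sInf_mem (s := {j : ℕ | 1 ≤ j ∧
      latticeDist N ((j : ℝ) • v) < latticeDist N ((k : ℝ) • v)}) (hv k hk)
    exact ⟨⟨_, hmem.1⟩, hmem, fun j hj => Nat.sInf_le hj⟩
  choose f hf using hl
  choose p hp using fun x => exists_latticeDist_eq hN x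
  set q : ℕ → {k : ℕ // 1 ≤ k} := fun n => f^[n] ⟨1, le_rfl⟩ with hq
  have hqs : ∀ n, q (n + 1) = f (q n) := fun n => Function.iterate_succ_apply' f n _
  have hlt : ∀ n, latticeDist N (((q (n + 1)).1 : ℝ) • v) <
      latticeDist N (((q n).1 : ℝ) • v) := by
    intro n
    rw [hqs]
    exact (hf (q n)).1.2
  refine ⟨fun n => (q n).1, fun n => p (((q n).1 : ℝ) • v), rfl, ?_, fun n => ?_, fun n => hp _⟩
  · refine strictMono_nat_of_lt_succ fun n => lt_of_le_of_ne ?_ fun h => ?_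
    · cases n with
      | zero => exact (q 1).2
      | succ n =>
        have h1 := hf (q n)
        rw [← hqs] at h1
        exact h1.2 ⟨(q (n + 2)).2, (hlt (n + 1)).trans (hlt n)⟩
    · have := hlt n
      rw [← h] at this
      exact lt_irrefl _ this
  · simp only [hqs]
    exact hf (q n)

lemma dirichletFun_le (N : Seminorm ℝ (Fin d → ℝ)) (v : Fin d → ℝ) {T : ℝ} (hT : 0 ≤ T) {k : ℕ}
    (hk : 1 ≤ k) (hkT : (k : ℝ) ≤ T) :
    dirichletFun N v T ≤ T ^ (1 / (d : ℝ)) * latticeDist N ((k : ℝ) • v) := by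
  refine mul_le_mul_of_nonneg_left (csInf_le ⟨0, ?_⟩ ⟨k, ⟨hk, hkT⟩, rfl⟩) (by positivity)
  rintro _ ⟨j, -, rfl⟩
  exact latticeDist_nonneg N _

lemma le_dirichletFun (N : Seminorm ℝ (Fin d → ℝ)) (v : Fin d → ℝ) {T r : ℝ} (hT : 1 ≤ T)
    (h : ∀ k : ℕ, 1 ≤ k → (k : ℝ) ≤ T → r ≤ latticeDist N ((k : ℝ) • v)) :
    T ^ (1 / (d : ℝ)) * r ≤ dirichletFun N v T := by
  refine mul_le_mul_of_nonneg_left (le_csInf ⟨_, 1, ⟨le_rfl, by simpa using hT⟩, rfl⟩ ?_)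
    (by positivity)
  rintro _ ⟨j, ⟨h1, h2⟩, rfl⟩
  exact h j h1 h2

/-- On `[q_n, q_{n+1})` the function `dirichletFun` is `T^{1/d} ⟨q_n v⟩`, so its upper limit is
that of the values just before the jumps, which are the norms of the long displacements. -/
theorem limitingDirichletSpectrum_subset (N : Seminorm ℝ (Fin d → ℝ)) :
    limitingDirichletSpectrum N ⊆ dirichletSpectrum N := by
  rintro s ⟨v, hv, q, p, h, hlim⟩
  refine ⟨v, hv, le_antisymm ?_ ?_⟩
  · refine le_of_forall_gt_imp_ge_of_dense fun r hr => ?_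
    induction r with
    | bot => exact absurd hr not_lt_bot
    | top => exact le_top
    | coe r =>
    have hr' : s < r := by exact_mod_cast hr
    obtain ⟨n₀, hn₀⟩ := eventually_atTop.1 (hlim.eventually (gt_mem_nhds hr'))
    refine limsup_le_of_le (by isBoundedDefault) ?_
    filter_upwards [eventually_ge_atTop (q n₀ : ℝ)] with T hT
    have hT0 : 0 ≤ T := le_trans (by positivity) hT
    -- the index `n` with `q n ≤ T < q (n + 1)`
    obtain ⟨n, hn1, hn2⟩ : ∃ n, q n ≤ ⌊T⌋₊ ∧ ⌊T⌋₊ < q (n + 1) := by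
      have hex : ∃ n, ⌊T⌋₊ < q n := ⟨⌊T⌋₊ + 1, (Nat.lt_succ_self _).trans_le
        (h.strictMono.id_le _)⟩
      have hpos : Nat.find hex ≠ 0 := by
        intro h0
        have h1 := Nat.find_spec hex
        rw [h0] at h1
        exact absurd (h.strictMono.monotone (Nat.zero_le n₀))
          (not_le.2 ((Nat.le_floor hT).trans_lt h1))
      obtain ⟨n, hn⟩ := Nat.exists_eq_succ_of_ne_zero hpos
      refine ⟨n, not_lt.1 (Nat.find_min hex (by omega)), ?_⟩
      have := Nat.find_spec hex
      rwa [hn] at this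
    have hn : n₀ ≤ n := by
      by_contra! hlt
      have : q (n + 1) ≤ q n₀ := h.strictMono.monotone hlt
      have := Nat.le_floor hT
      omega
    have hTq : T ≤ q (n + 1) := ((Nat.floor_lt hT0).1 hn2).le
    have h1 := dirichletFun_le N v hT0 (h.one_le n) ((Nat.le_floor_iff hT0).1 hn1)
    have h2 := hn₀ n hn
    rw [h.seminorm_longDisplacement] at h2
    have h3 : T ^ (1 / (d : ℝ)) * latticeDist N ((q n : ℝ) • v) ≤
        (q (n + 1) : ℝ) ^ (1 / (d : ℝ)) * latticeDist N ((q n : ℝ) • v) :=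
      mul_le_mul_of_nonneg_right (Real.rpow_le_rpow hT0 hTq (by positivity))
        (latticeDist_nonneg N _)
    exact_mod_cast (h1.trans (h3.trans h2.le))
  · refine le_of_forall_lt_imp_le_of_dense fun r hr => ?_
    induction r with
    | top => exact absurd hr not_top_lt
    | bot => exact bot_le
    | coe r =>
    have hr' : r < s := by exact_mod_cast hr
    have hq : Tendsto (fun n => (q (n + 1) : ℝ)) atTop atTop :=
      tendsto_natCast_atTop_atTop.comp
        (h.strictMono.tendsto_atTop.comp (tendsto_add_atTop_nat 1))
    -- just before the jump, at `T = q (n + 1) - 1`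
    have hfac : Tendsto (fun n => ((q (n + 1) - 1) / q (n + 1) : ℝ) ^ (1 / (d : ℝ))) atTop
        (𝓝 1) := by
      have h1 : Tendsto (fun n => ((q (n + 1) - 1) / q (n + 1) : ℝ)) atTop (𝓝 1) := by
        have h2 := (tendsto_inv_atTop_zero.comp hq).const_sub 1
        rw [sub_zero] at h2
        refine h2.congr fun n => ?_
        have : (q (n + 1) : ℝ) ≠ 0 := by
          have := h.one_le (n + 1)
          positivity
        simp only [Function.comp]
        field_simp
      have := h1.rpow_const (p := 1 / (d : ℝ)) (Or.inl one_ne_zero)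
      rwa [Real.one_rpow] at this
    have hprod := hfac.mul hlim
    rw [one_mul] at hprod
    refine le_limsup_of_frequently_le ?_ (by isBoundedDefault)
    have hT : Tendsto (fun n => (q (n + 1) : ℝ) - 1) atTop atTop :=
      tendsto_atTop_add_const_right _ _ hq
    refine hT.frequently (Eventually.frequently ?_)
    filter_upwards [hprod.eventually (lt_mem_nhds hr')] with n hn
    have h2 : 2 ≤ q (n + 1) := (h.one_le n).trans_lt (h.strictMono n.lt_succ_self)
    have h2' : (2 : ℝ) ≤ q (n + 1) := by exact_mod_cast h2
    have h1 := le_dirichletFun N v (T := (q (n + 1) : ℝ) - 1)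
      (r := latticeDist N ((q n : ℝ) • v)) (by linarith) (fun k hk hkT => by
        refine h.latticeDist_le n hk ?_
        have : (k : ℝ) < q (n + 1) := by linarith
        exact_mod_cast this)
    rw [h.seminorm_longDisplacement, ← mul_assoc, ← Real.mul_rpow
      (div_nonneg (by linarith) (by positivity)) (by positivity),
      div_mul_cancel₀ _ (by positivity)] at hn
    exact_mod_cast hn.le.trans h1

end Basics

/-! ### A shortest vector in a planar lattice -/

section ShortVector

/-- The inner product `a x₀ y₀ + c x₁ y₁`, whose norm is `ellipseNorm a c`. -/
def ellipseInner (a c : ℝ) (x y : Fin 2 → ℝ) : ℝ := a * (x 0 * y 0) + c * (x 1 * y 1)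

/-- The determinant of two plane vectors. -/
def cross (x y : Fin 2 → ℝ) : ℝ := x 0 * y 1 - x 1 * y 0

lemma ellipseNorm_sq {a c : ℝ} (ha : 0 < a) (hc : 0 < c) (u : Fin 2 → ℝ) :
    ellipseNorm a c u ^ 2 = ellipseInner a c u u := by
  rw [ellipseNorm, Real.sq_sqrt (by positivity), ellipseInner]
  ring

lemma ellipseNorm_nonneg (a c : ℝ) (u : Fin 2 → ℝ) : 0 ≤ ellipseNorm a c u := Real.sqrt_nonneg _

lemma ellipseInner_self_pos {a c : ℝ} (ha : 0 < a) (hc : 0 < c) {u : Fin 2 → ℝ} (hu : u ≠ 0) :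
    0 < ellipseInner a c u u := by
  have h : u 0 ≠ 0 ∨ u 1 ≠ 0 := by
    by_contra! h
    exact hu (by ext i; fin_cases i <;> simp [h.1, h.2])
  rw [ellipseInner]
  rcases h with h | h
  · have := mul_self_pos.2 h
    have := mul_self_nonneg (u 1)
    positivity
  · have := mul_self_pos.2 h
    have := mul_self_nonneg (u 0)
    positivity

/-- Let `Y, Z` span a lattice of determinant `t`, let the projection of `Z` to `Y` be within `σ` of
a half-integer multiple of `Y`, and let `Y` be short relative to `t`. Then no lattice vector off
the line of `Y` is shorter than `Y`: in the ellipse norm such vectors are longer than `Y` by more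
than the distortion `D`. -/
lemma IsEllipsoidNormFor.lt_of_projection_near_half {N : Seminorm ℝ (Fin 2 → ℝ)} {a c D : ℝ}
    (h : IsEllipsoidNormFor N a c D) {Y Z : Fin 2 → ℝ} {t σ τ : ℝ} {j : ℤ} (hY : Y ≠ 0)
    (hdet : cross Y Z ^ 2 = t ^ 2) (hτ : τ * ellipseInner a c Y Y = ellipseInner a c Y Z)
    (hσ0 : 0 ≤ σ) (hσ : σ ≤ 1 / 2) (hj : |τ - j - 1 / 2| ≤ σ)
    (hshort : ellipseInner a c Y Y ^ 2 * (D ^ 2 - (1 / 2 - σ) ^ 2) < a * c * t ^ 2)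
    (B C : ℤ) (hC : C ≠ 0) : N Y < N ((B : ℝ) • Y + (C : ℝ) • Z) := by
  obtain ⟨ha, hc, hD, hN⟩ := h
  set W := (B : ℝ) • Y + (C : ℝ) • Z with hW
  have hE := ellipseInner_self_pos ha hc hY
  set E := ellipseInner a c Y Y with hEdef
  have hlag : E * ellipseInner a c W W = (E * (B + C * τ)) ^ 2 + C ^ 2 * (a * c * t ^ 2) := by
    have h1 : E * ellipseInner a c W W =
        (ellipseInner a c Y W) ^ 2 + a * c * cross Y W ^ 2 := by
      simp only [hEdef, ellipseInner, cross]; ring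
    have h2 : ellipseInner a c Y W = B * E + C * ellipseInner a c Y Z := by
      simp [hEdef, ellipseInner, hW]; ring
    have h3 : cross Y W = C * cross Y Z := by
      simp [cross, hW]; ring
    rw [h1, h2, h3, ← hτ, mul_pow, hdet]; ring
  have hkey : E ^ 2 * D ^ 2 < E * ellipseInner a c W W := by
    rw [hlag]
    have hEE : 0 < E ^ 2 := by positivity
    have hD2 : 1 ≤ D ^ 2 := one_le_pow₀ hD
    rcases (show C.natAbs = 1 ∨ 2 ≤ C.natAbs by omega) with h1 | h2
    · have hCC : (C : ℝ) ^ 2 = 1 := by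
        have : C ^ 2 = 1 := by
          rw [← Int.natAbs_sq, h1]; norm_num
        exact_mod_cast this
      -- `B + C τ` differs from `± 1/2` modulo `1` by at most `σ`
      have hBC : (1 / 2 - σ) ^ 2 ≤ (B + C * τ) ^ 2 := by
        have hx : ∀ n : ℤ, (1 / 2 - σ) ^ 2 ≤ (n + (τ - j)) ^ 2 := by
          intro n
          rw [abs_le] at hj
          rcases le_or_gt 0 n with hn | hn
          · have : (0 : ℝ) ≤ n := by exact_mod_cast hn
            nlinarith
          · have : (n : ℝ) ≤ -1 := by exact_mod_cast Int.le_sub_one_of_lt hn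
            nlinarith
        rcases Int.natAbs_eq C with h | h <;> rw [h1] at h <;> subst h
        · have := hx (B + j)
          push_cast at this ⊢
          convert this using 2; ring
        · have := hx (-B + j)
          push_cast at this ⊢
          convert this using 1; ring
      rw [hCC, one_mul, mul_pow]
      nlinarith
    · have hCC : (4 : ℝ) ≤ (C : ℝ) ^ 2 := by
        have h4 : 4 ≤ C ^ 2 := by
          rw [← Int.natAbs_sq]
          have : (2 : ℤ) ≤ C.natAbs := by exact_mod_cast h2
          nlinarith
        exact_mod_cast h4
      have hs : (1 / 2 - σ) ^ 2 ≤ 1 / 4 := by nlinarith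
      have h5 : E ^ 2 * (3 / 4 * D ^ 2) < a * c * t ^ 2 :=
        lt_of_le_of_lt (mul_le_mul_of_nonneg_left (by nlinarith) hEE.le) hshort
      have h6 : 4 * (a * c * t ^ 2) ≤ (C : ℝ) ^ 2 * (a * c * t ^ 2) :=
        mul_le_mul_of_nonneg_right hCC (by positivity)
      have h7 : 0 ≤ (E * (B + C * τ)) ^ 2 := sq_nonneg _
      have h8 : 0 < E ^ 2 * D ^ 2 := by positivity
      linarith
  have hlt : E * D ^ 2 < ellipseInner a c W W := by
    refine lt_of_mul_lt_mul_left ?_ hE.le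
    calc E * (E * D ^ 2) = E ^ 2 * D ^ 2 := by ring
      _ < _ := hkey
  have h9 : D * ellipseNorm a c Y < ellipseNorm a c W := by
    refine lt_of_pow_lt_pow_left₀ 2 (ellipseNorm_nonneg a c W) ?_
    rw [mul_pow, ellipseNorm_sq ha hc, ellipseNorm_sq ha hc, ← hEdef]
    linarith
  exact (hN Y).2.trans_lt (h9.trans_le (hN W).1)

/-- Subtracting multiples of a small `σ > 0` brings a number within `σ` of `1/2` modulo `1`. -/
lemma exists_nat_mul_near_half (θ : ℝ) {σ : ℝ} (hσ : 0 < σ) :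
    ∃ (i : ℕ) (j : ℤ), (i : ℝ) ≤ 1 / σ ∧ |θ - i * σ - j - 1 / 2| ≤ σ := by
  have h0 := Int.fract_nonneg (θ - 1 / 2)
  have h1 := Int.fract_lt_one (θ - 1 / 2)
  have h2 := Int.self_sub_floor (θ - 1 / 2)
  set f := Int.fract (θ - 1 / 2)
  have h3 := Nat.floor_le (div_nonneg h0 hσ.le)
  have h4 := Nat.lt_floor_add_one (f / σ)
  refine ⟨⌊f / σ⌋₊, ⌊θ - 1 / 2⌋, h3.trans (by gcongr), ?_⟩
  rw [le_div_iff₀ hσ] at h3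
  rw [div_lt_iff₀ hσ] at h4
  rw [abs_le]
  constructor <;> nlinarith

end ShortVector

/-! ### One step of the construction -/

section Step

lemma ellipseInner_continuous (a c : ℝ) :
    Continuous fun x : (Fin 2 → ℝ) × (Fin 2 → ℝ) => ellipseInner a c x.1 x.2 := by
  unfold ellipseInner
  fun_prop

lemma tendsto_inv_smul_add (u w : Fin 2 → ℝ) :
    Tendsto (fun m : ℕ => (m : ℝ)⁻¹ • ((m : ℝ) • u + w)) atTop (𝓝 u) := by
  have h1 : Tendsto (fun m : ℕ => u + (m : ℝ)⁻¹ • w) atTop (𝓝 (u + (0 : ℝ) • w)) :=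
    (tendsto_inv_atTop_nhds_zero_nat.smul_const w).const_add u
  rw [zero_smul, add_zero] at h1
  refine h1.congr' ?_
  filter_upwards [eventually_gt_atTop 0] with m hm
  have : (m : ℝ) ≠ 0 := by positivity
  rw [smul_add, smul_smul, inv_mul_cancel₀ this, one_smul]

/-- With `Y = m u + w`, the coefficient `k` can be chosen so that the denominator `qf + m qg + k q`
is asymptotic to `N(Y)² / s²`, while the projection of `h - k u` to `Y` comes close to a
half-integer multiple of `Y`: raising `k` by one moves this projection by only
`σ ≈ 1 / m`, so `O(m)` further steps suffice, against a main term of order `m²`. -/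
lemma exists_coefficients (N : Seminorm ℝ (Fin 2 → ℝ)) {a c : ℝ} (ha : 0 < a) (hc : 0 < c)
    (u w h : Fin 2 → ℝ) (hu : u ≠ 0) {s q : ℝ} (hs : 0 < s) (hq : 0 < q) (qg qf : ℝ) :
    ∃ (k : ℕ → ℕ) (σ : ℕ → ℝ) (j : ℕ → ℤ),
      Tendsto (fun m : ℕ => (qf + m * qg + k m * q) / (m : ℝ) ^ 2) atTop (𝓝 (N u ^ 2 / s ^ 2)) ∧
      Tendsto σ atTop (𝓝 0) ∧
      ∀ᶠ m : ℕ in atTop, 0 ≤ σ m ∧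
        |ellipseInner a c ((m : ℝ) • u + w) (h - (k m : ℝ) • u) /
          ellipseInner a c ((m : ℝ) • u + w) ((m : ℝ) • u + w) - j m - 1 / 2| ≤ σ m := by
  set Y : ℕ → Fin 2 → ℝ := fun m => (m : ℝ) • u + w with hY
  have hy := tendsto_inv_smul_add u w
  have hinv : Tendsto (fun m : ℕ => (m : ℝ)⁻¹) atTop (𝓝 0) := tendsto_inv_atTop_nhds_zero_nat
  have hE := ellipseInner_self_pos ha hc hu
  set σ : ℕ → ℝ := fun m => ellipseInner a c (Y m) u / ellipseInner a c (Y m) (Y m) with hσ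
  have hmσ : Tendsto (fun m : ℕ => m * σ m) atTop (𝓝 1) := by
    have h1 := ((ellipseInner_continuous a c).tendsto (u, u)).comp
      (hy.prodMk_nhds (tendsto_const_nhds (x := u)))
    have h2 := ((ellipseInner_continuous a c).tendsto (u, u)).comp (hy.prodMk_nhds hy)
    have h3 := h1.div h2 hE.ne'
    simp only [div_self hE.ne'] at h3
    refine h3.congr' ?_
    filter_upwards [eventually_gt_atTop 0] with m hm
    have : (m : ℝ) ≠ 0 := by positivity
    have e1 : ellipseInner a c ((m : ℝ)⁻¹ • Y m) u = (m : ℝ)⁻¹ * ellipseInner a c (Y m) u := by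
      simp [ellipseInner]; ring
    have e2 : ellipseInner a c ((m : ℝ)⁻¹ • Y m) ((m : ℝ)⁻¹ • Y m) =
        (m : ℝ)⁻¹ * ((m : ℝ)⁻¹ * ellipseInner a c (Y m) (Y m)) := by
      simp [ellipseInner]; ring
    simp only [Pi.div_apply, Function.comp, hσ]
    rw [e1, e2, mul_div_mul_left _ _ (inv_ne_zero this), inv_mul_eq_div, div_div_eq_mul_div]
    ring
  have hσ0 : Tendsto σ atTop (𝓝 0) := by
    have h1 := hmσ.mul hinv
    rw [one_mul] at h1
    refine h1.congr' ?_
    filter_upwards [eventually_gt_atTop 0] with m hm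
    have : (m : ℝ) ≠ 0 := by positivity
    field_simp
  have hσpos : ∀ᶠ m in atTop, 0 < σ m := by
    filter_upwards [hmσ.eventually (lt_mem_nhds one_pos), eventually_gt_atTop 0] with m h1 h2
    have : (0 : ℝ) < m := by positivity
    exact pos_of_mul_pos_right h1 this.le
  set k₀ : ℕ → ℕ := fun m => ⌈N (Y m) ^ 2 / (s ^ 2 * q)⌉₊ with hk₀
  have hex : ∀ m, ∃ (i : ℕ) (j : ℤ), 0 < σ m → ((i : ℝ) ≤ 1 / σ m ∧
      |ellipseInner a c (Y m) (h - (k₀ m : ℝ) • u) / ellipseInner a c (Y m) (Y m)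
        - i * σ m - j - 1 / 2| ≤ σ m) := by
    intro m
    by_cases hm : 0 < σ m
    · obtain ⟨i, j, hij⟩ := exists_nat_mul_near_half
        (ellipseInner a c (Y m) (h - (k₀ m : ℝ) • u) / ellipseInner a c (Y m) (Y m)) hm
      exact ⟨i, j, fun _ => hij⟩
    · exact ⟨0, 0, fun h => absurd h hm⟩
  choose i j hij using hex
  refine ⟨fun m => k₀ m + i m, σ, j, ?_, hσ0, ?_⟩
  · have hNY : Tendsto (fun m : ℕ => N (Y m) ^ 2 / (m : ℝ) ^ 2) atTop (𝓝 (N u ^ 2)) := by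
      have h1 := (((seminorm_continuous N).tendsto u).comp hy).pow 2
      refine h1.congr fun m => ?_
      simp only [Function.comp, map_smul_eq_mul, norm_inv, Real.norm_natCast, hY]
      rw [mul_pow, inv_pow, inv_mul_eq_div]
    have hk0 : Tendsto (fun m : ℕ => (k₀ m : ℝ) / (m : ℝ) ^ 2) atTop
        (𝓝 (N u ^ 2 / (s ^ 2 * q))) := by
      have h1 := hNY.div_const (s ^ 2 * q)
      have h2 := h1.add (hinv.pow 2)
      rw [zero_pow two_ne_zero, add_zero] at h2
      refine tendsto_of_tendsto_of_tendsto_of_le_of_le' h1 h2 ?_ ?_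
      · filter_upwards with m
        rw [div_right_comm]
        exact div_le_div_of_nonneg_right (Nat.le_ceil _) (by positivity)
      · filter_upwards with m
        rw [div_right_comm, inv_pow, ← one_div, ← add_div]
        exact div_le_div_of_nonneg_right (Nat.ceil_lt_add_one (by positivity)).le (by positivity)
    have hi : Tendsto (fun m : ℕ => (i m : ℝ) / (m : ℝ) ^ 2) atTop (𝓝 0) := by
      have h1 := (hmσ.inv₀ one_ne_zero).mul hinv
      rw [mul_zero] at h1
      refine tendsto_of_tendsto_of_tendsto_of_le_of_le' tendsto_const_nhds h1 ?_ ?_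
      · filter_upwards with m
        positivity
      · filter_upwards [hσpos] with m hm
        have := (hij m hm).1
        calc (i m : ℝ) / (m : ℝ) ^ 2 ≤ (1 / σ m) / (m : ℝ) ^ 2 :=
              div_le_div_of_nonneg_right this (by positivity)
          _ = _ := by
            simp only [div_eq_mul_inv, one_mul, mul_inv, sq]
            ring
    have h1 := (((hinv.pow 2).const_mul qf).add (hinv.const_mul qg)).add
      ((hk0.add hi).mul_const q)
    have h2 : qf * 0 ^ 2 + qg * 0 + (N u ^ 2 / (s ^ 2 * q) + 0) * q = N u ^ 2 / s ^ 2 := by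
      field_simp
      ring
    rw [h2] at h1
    refine h1.congr' ?_
    filter_upwards [eventually_gt_atTop 0] with m hm
    have : (m : ℝ) ≠ 0 := by positivity
    push_cast
    field_simp
  · filter_upwards [hσpos] with m hm
    refine ⟨hm.le, ?_⟩
    have h1 := (hij m hm).2
    convert h1 using 4
    rw [hσ]
    simp only [← mul_div_assoc, ← sub_div]
    congr 1
    simp [ellipseInner, hY]
    ring

/-- A basis of `ℤ³` whose first vector `(q, p)` has positive height `q`. -/
structure ApproxBasis where
  (q : ℕ) (p : Fin 2 → ℤ)
  (qg : ℤ) (g : Fin 2 → ℤ)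
  (qf : ℤ) (f : Fin 2 → ℤ)
  q_pos : 0 < q
  det_eq : q * (g 0 * f 1 - g 1 * f 0) - qg * (p 0 * f 1 - p 1 * f 0)
    + qf * (p 0 * g 1 - p 1 * g 0) = 1

/-- The rational point `p / q`. -/
noncomputable def ApproxBasis.point (X : ApproxBasis) : Fin 2 → ℝ := (X.q : ℝ)⁻¹ • intVec X.p

lemma ApproxBasis.smul_point (X : ApproxBasis) : (X.q : ℝ) • X.point = intVec X.p := by
  have : (X.q : ℝ) ≠ 0 := by exact_mod_cast X.q_pos.ne'
  rw [point, smul_smul, mul_inv_cancel₀ this, one_smul]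

/-- From `p / q` one passes to a nearby rational point `p' / q'` with much larger denominator, for
which `q` is, up to the symmetry `k ↦ q' - k`, the only minimum of `⟨k p' / q'⟩` over `0 < k < q'`,
with `√q' ⟨q p' / q'⟩` close to a prescribed `s`. -/
lemma ApproxBasis.exists_next {N : Seminorm ℝ (Fin 2 → ℝ)} (hN : ∀ x, N x = 0 → x = 0)
    {a c D : ℝ} (h : IsEllipsoidNormFor N a c D) {s : ℝ} (hs : 0 < s)
    (hsM : s ^ 4 * (D ^ 2 - 1 / 4) < a * c) (X : ApproxBasis) {ε : ℝ} (hε : 0 < ε) :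
    ∃ X' : ApproxBasis, (X.q : ℝ) < ε * X'.q ∧ ‖X'.point - X.point‖ < ε ∧
      |√X'.q * N ((X.q : ℝ) • X'.point - intVec X.p) - s| < ε ∧
      0 < N ((X.q : ℝ) • X'.point - intVec X.p) ∧
      ∀ (k : ℕ) (z : Fin 2 → ℤ), 0 < k → k < X'.q →
        N ((X.q : ℝ) • X'.point - intVec X.p) ≤ N ((k : ℝ) • X'.point - intVec z) ∧
        (k ≠ X.q → k + X.q ≠ X'.q →
          N ((X.q : ℝ) • X'.point - intVec X.p) < N ((k : ℝ) • X'.point - intVec z)) := by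
  obtain ⟨ha, hc, hD, hNE⟩ := id h
  obtain ⟨q, p, qg, g, qf, f, hq, hdet⟩ := X
  simp only [ApproxBasis.point]
  have hqR : (0 : ℝ) < q := by exact_mod_cast hq
  -- the integer vectors `q g - qg p`, `q f - qf p`, `qg f - qf g`
  set u : Fin 2 → ℝ := fun i => q * g i - qg * p i with hu
  set w : Fin 2 → ℝ := fun i => q * f i - qf * p i with hw
  set t : Fin 2 → ℝ := fun i => qg * f i - qf * g i with ht
  have hdetR : (q : ℝ) * (g 0 * f 1 - g 1 * f 0) - qg * (p 0 * f 1 - p 1 * f 0)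
    + qf * (p 0 * g 1 - p 1 * g 0) = 1 := by exact_mod_cast hdet
  have huw : cross u w = q := by
    simp only [cross, hu, hw]
    linear_combination (q : ℝ) * hdetR
  have hu0 : u ≠ 0 := by
    intro h0
    rw [h0] at huw
    simp [cross] at huw
    exact hqR.ne huw
  have hNu : 0 < N u := seminorm_pos hN hu0
  obtain ⟨k, σ, j, hQ, hσ, hev⟩ := exists_coefficients N ha hc u w t hu0 hs hqR qg qf
  set Y : ℕ → Fin 2 → ℝ := fun m => (m : ℝ) • u + w with hY
  set Q : ℕ → ℝ := fun m => qf + m * qg + k m * q with hQdef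
  have hL : 0 < N u ^ 2 / s ^ 2 := by positivity
  have hinv : Tendsto (fun m : ℕ => (m : ℝ)⁻¹) atTop (𝓝 0) := tendsto_inv_atTop_nhds_zero_nat
  have hy := tendsto_inv_smul_add u w
  have hQtop : Tendsto Q atTop atTop := by
    have h1 : Tendsto (fun m : ℕ => (m : ℝ) ^ 2) atTop atTop :=
      (tendsto_pow_atTop two_ne_zero).comp tendsto_natCast_atTop_atTop
    refine (hQ.pos_mul_atTop hL h1).congr' ?_
    filter_upwards [eventually_gt_atTop 0] with m hm
    have : (m : ℝ) ≠ 0 := by positivity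
    simp only [hQdef]
    field_simp
  have hdisp : Tendsto (fun m => (Q m * q)⁻¹ • Y m) atTop (𝓝 0) := by
    have h1 := (((hQ.inv₀ hL.ne').mul hinv).mul_const (q : ℝ)⁻¹).smul hy
    rw [mul_zero, zero_mul, zero_smul] at h1
    refine h1.congr' ?_
    filter_upwards [eventually_gt_atTop 0] with m hm
    have : (m : ℝ) ≠ 0 := by positivity
    simp only [hQdef]
    rw [smul_smul]
    congr 1
    field_simp
  have hlim : Tendsto (fun m => N (Y m) / √(Q m)) atTop (𝓝 s) := by
    have h1 := (((seminorm_continuous N).tendsto u).comp hy).div hQ.sqrt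
      (Real.sqrt_ne_zero'.2 hL)
    have h2 : N u / √(N u ^ 2 / s ^ 2) = s := by
      rw [Real.sqrt_div (by positivity), Real.sqrt_sq hNu.le, Real.sqrt_sq hs.le]
      field_simp
    rw [h2] at h1
    refine h1.congr' ?_
    filter_upwards [eventually_gt_atTop 0] with m hm
    have : (m : ℝ) ≠ 0 := by positivity
    simp only [Pi.div_apply, Function.comp, map_smul_eq_mul, norm_inv, Real.norm_natCast]
    rw [Real.sqrt_div' _ (by positivity), Real.sqrt_sq (by positivity), div_div_eq_mul_div]
    congr 1
    field_simp
    rfl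
  have hshort : ∀ᶠ m in atTop,
      (N (Y m) / √(Q m)) ^ 4 * (D ^ 2 - (1 / 2 - σ m) ^ 2) < a * c := by
    have h1 := (hlim.pow 4).mul (((hσ.const_sub (1 / 2)).pow 2).const_sub (D ^ 2))
    refine h1.eventually (gt_mem_nhds ?_)
    rwa [show D ^ 2 - (1 / 2 - 0) ^ 2 = D ^ 2 - 1 / 4 by ring]
  obtain ⟨m, ⟨hσ0, hj⟩, hσ1, hshort, hs1, hd1, hQ1, hQ2⟩ := (hev.and
    ((hσ.eventually (ge_mem_nhds (show (0 : ℝ) < 1 / 2 by norm_num))).and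
    (hshort.and ((hlim.eventually (Metric.ball_mem_nhds s hε)).and
    ((hdisp.eventually (Metric.ball_mem_nhds 0 hε)).and
    ((hQtop.eventually_gt_atTop (q / ε)).and (hQtop.eventually_gt_atTop q))))))).exists
  -- the new vector `f + m g + k e`
  have hQZ : (((qf + m * qg + k m * q).toNat : ℕ) : ℤ) = qf + m * qg + k m * q := by
    refine Int.toNat_of_nonneg ?_
    have : (0 : ℝ) ≤ Q m := hqR.le.trans hQ2.le
    simp only [hQdef] at this
    exact_mod_cast this
  obtain ⟨q', hq'⟩ : ∃ q' : ℕ, (q' : ℤ) = qf + m * qg + k m * q := ⟨_, hQZ⟩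
  have hq'R : (q' : ℝ) = Q m := by
    simp only [hQdef]
    exact_mod_cast hq'
  have hq'pos : (0 : ℝ) < q' := by rw [hq'R]; linarith
  set p' : Fin 2 → ℤ := fun i => f i + m * g i + k m * p i with hp'
  have hdet' : (q' : ℤ) * (p 0 * g 1 - p 1 * g 0) - q * (p' 0 * g 1 - p' 1 * g 0)
      + qg * (p' 0 * p 1 - p' 1 * p 0) = 1 := by
    rw [hq']
    simp only [hp']
    linear_combination hdet
  have hxe : (q : ℝ) • ((q' : ℝ)⁻¹ • intVec p') - intVec p = (q' : ℝ)⁻¹ • Y m := by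
    ext i
    have h1 : (q' : ℝ) = qf + m * qg + k m * q := hq'R
    simp only [intVec, hp', hY, hu, hw, Pi.sub_apply, Pi.smul_apply, Pi.add_apply, smul_eq_mul]
    field_simp
    push_cast
    rw [h1]
    ring
  have hxg : (qg : ℝ) • ((q' : ℝ)⁻¹ • intVec p') - intVec g =
      (q' : ℝ)⁻¹ • (t - (k m : ℝ) • u) := by
    ext i
    have h1 : (q' : ℝ) = qf + m * qg + k m * q := hq'R
    simp only [intVec, hp', ht, hu, Pi.sub_apply, Pi.smul_apply, smul_eq_mul]
    field_simp
    push_cast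
    rw [h1]
    ring
  have hY0 : Y m ≠ 0 := by
    intro h0
    have h1 : cross u (Y m) = q := by
      rw [← huw]
      simp only [cross, hY, Pi.add_apply, Pi.smul_apply, smul_eq_mul]
      ring
    rw [h0] at h1
    simp [cross] at h1
    exact hqR.ne h1
  have hNY : 0 < N (Y m) := seminorm_pos hN hY0
  have hNinv : ∀ x : Fin 2 → ℝ, N ((q' : ℝ)⁻¹ • x) = (q' : ℝ)⁻¹ * N x := fun x => by
    rw [map_smul_eq_mul, norm_inv, Real.norm_natCast]
  have hcross : cross (Y m) (t - (k m : ℝ) • u) ^ 2 = (q' : ℝ) ^ 2 := by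
    have h1 : cross (Y m) (t - (k m : ℝ) • u) = (q' : ℝ) *
        (q * (g 0 * f 1 - g 1 * f 0) - qg * (p 0 * f 1 - p 1 * f 0)
          + qf * (p 0 * g 1 - p 1 * g 0)) := by
      rw [hq'R]
      simp only [cross, hQdef, hY, ht, hu, hw, Pi.sub_apply, Pi.smul_apply, Pi.add_apply,
        smul_eq_mul]
      ring
    rw [h1, hdetR, mul_one]
  have hshort' : ellipseInner a c (Y m) (Y m) ^ 2 * (D ^ 2 - (1 / 2 - σ m) ^ 2) <
      a * c * (q' : ℝ) ^ 2 := by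
    have h1 : ellipseInner a c (Y m) (Y m) ≤ N (Y m) ^ 2 := by
      rw [← ellipseNorm_sq ha hc]
      exact pow_le_pow_left₀ (ellipseNorm_nonneg _ _ _) (hNE (Y m)).1 2
    have h2 : (N (Y m) / √(Q m)) ^ 4 = (N (Y m) ^ 2) ^ 2 / (q' : ℝ) ^ 2 := by
      rw [div_pow, ← hq'R, show √(q' : ℝ) ^ 4 = (√(q' : ℝ) ^ 2) ^ 2 by ring,
        Real.sq_sqrt hq'pos.le]
      ring
    rw [h2, div_mul_eq_mul_div, div_lt_iff₀ (by positivity)] at hshort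
    refine lt_of_le_of_lt (mul_le_mul_of_nonneg_right (pow_le_pow_left₀
      (ellipseInner_self_pos ha hc hY0).le h1 2) ?_) hshort
    nlinarith
  have hmain := h.lt_of_projection_near_half (Z := t - (k m : ℝ) • u) hY0 hcross
    (div_mul_cancel₀ _ (ellipseInner_self_pos ha hc hY0).ne') hσ0 hσ1 hj hshort'
  refine ⟨⟨q', p', q, p, qg, g, by exact_mod_cast hq'pos, hdet'⟩, ?_, ?_, ?_, ?_, ?_⟩
  · rw [hq'R]
    rwa [div_lt_iff₀' hε] at hQ1
  · have h1 : (q' : ℝ)⁻¹ • intVec p' - (q : ℝ)⁻¹ • intVec p = (Q m * q)⁻¹ • Y m := by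
      have h2 := congrArg (fun x => (q : ℝ)⁻¹ • x) hxe
      simp only [smul_sub, smul_smul] at h2
      rw [← mul_assoc, inv_mul_cancel₀ hqR.ne', one_mul] at h2
      rw [h2, ← hq'R, mul_inv, mul_comm]
    rw [h1]
    simpa using hd1
  · rw [hxe, hNinv]
    have h1 : √(q' : ℝ) * ((q' : ℝ)⁻¹ * N (Y m)) = N (Y m) / √(Q m) := by
      rw [← hq'R]
      have h3 : √(q' : ℝ) ≠ 0 := (Real.sqrt_pos.2 hq'pos).ne'
      have h4 := Real.sq_sqrt hq'pos.le
      field_simp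
      rw [h4]
    rw [h1]
    simpa [Real.dist_eq] using hs1
  · rw [hxe, hNinv]
    positivity
  · intro l z hl hlq
    change l < q' at hlq
    simp only
    -- coordinates of `(l, z)` in the basis `e', e, g`
    obtain ⟨A, hA⟩ : ∃ A : ℤ, A = l * (p 0 * g 1 - p 1 * g 0) - q * (z 0 * g 1 - z 1 * g 0)
      + qg * (z 0 * p 1 - z 1 * p 0) := ⟨_, rfl⟩
    obtain ⟨B, hB⟩ : ∃ B : ℤ, B = q' * (z 0 * g 1 - z 1 * g 0) - l * (p' 0 * g 1 - p' 1 * g 0)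
      + qg * (p' 0 * z 1 - p' 1 * z 0) := ⟨_, rfl⟩
    obtain ⟨C, hC⟩ : ∃ C : ℤ, C = q' * (p 0 * z 1 - p 1 * z 0) - q * (p' 0 * z 1 - p' 1 * z 0)
      + l * (p' 0 * p 1 - p' 1 * p 0) := ⟨_, rfl⟩
    have hlABC : (l : ℤ) = A * q' + B * q + C * qg := by
      rw [hA, hB, hC]
      linear_combination (-(l : ℤ)) * hdet'
    have hz : ∀ i, z i = A * p' i + B * p i + C * g i := by
      intro i
      rw [hA, hB, hC]
      fin_cases i
      · simp only [Fin.zero_eta]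
        linear_combination (-(z 0)) * hdet'
      · simp only [Fin.mk_one]
        linear_combination (-(z 1)) * hdet'
    have hxl : (l : ℝ) • ((q' : ℝ)⁻¹ • intVec p') - intVec z =
        (q' : ℝ)⁻¹ • ((B : ℝ) • Y m + (C : ℝ) • (t - (k m : ℝ) • u)) := by
      have h1 : (l : ℝ) = A * q' + B * q + C * qg := by exact_mod_cast hlABC
      rw [smul_add, smul_comm _ (B : ℝ), smul_comm _ (C : ℝ), ← hxe, ← hxg]
      ext i
      simp only [intVec, Pi.sub_apply, Pi.smul_apply, Pi.add_apply, smul_eq_mul, hz i]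
      rw [h1]
      push_cast
      field_simp
      ring
    rw [hxe, hxl, hNinv, hNinv]
    have hqi : 0 < (q' : ℝ)⁻¹ := by positivity
    by_cases hC0 : C = 0
    · subst hC0
      have hB0 : B ≠ 0 := by
        rintro rfl
        simp only [zero_mul, add_zero] at hlABC
        have h1 : (0 : ℤ) < A * q' := by omega
        have h2 : A * q' < 1 * q' := by omega
        have h3 : (0 : ℤ) < q' := by exact_mod_cast hq'pos
        have h4 : 0 < A := pos_of_mul_pos_left h1 h3.le
        have h5 : A < 1 := lt_of_mul_lt_mul_right h2 h3.le
        omega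
      have hval : N ((B : ℝ) • Y m + ((0 : ℤ) : ℝ) • (t - (k m : ℝ) • u)) =
          |(B : ℝ)| * N (Y m) := by
        rw [Int.cast_zero, zero_smul, add_zero, map_smul_eq_mul, Real.norm_eq_abs]
      rw [hval]
      refine ⟨mul_le_mul_of_nonneg_left (le_mul_of_one_le_left hNY.le ?_) hqi.le, ?_⟩
      · exact_mod_cast Int.one_le_abs hB0
      · intro hl1 hl2
        refine mul_lt_mul_of_pos_left (lt_mul_of_one_lt_left hNY ?_) hqi
        have : 1 < |B| := by
          by_contra! hle
          have h3 : (0 : ℤ) < q' := by exact_mod_cast hq'pos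
          have h4 : (q : ℤ) < q' := by
            have : (q : ℝ) < q' := hq'R ▸ hQ2
            exact_mod_cast this
          have hB1 : B = 1 ∨ B = -1 := by
            rw [abs_le] at hle
            omega
          rcases hB1 with rfl | rfl
          · have h5 : A * q' < 1 * q' := by omega
            have h6 : -1 * q' < A * q' := by omega
            have h7 : A < 1 := lt_of_mul_lt_mul_right h5 h3.le
            have h8 : -1 < A := lt_of_mul_lt_mul_right h6 h3.le
            have h9 : A = 0 := by omega
            subst h9
            omega
          · have h5 : A * q' < 2 * q' := by omega
            have h6 : 0 * (q' : ℤ) < A * q' := by omega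
            have h7 : A < 2 := lt_of_mul_lt_mul_right h5 h3.le
            have h8 : 0 < A := lt_of_mul_lt_mul_right h6 h3.le
            have h9 : A = 1 := by omega
            subst h9
            omega
        exact_mod_cast this
    · have := mul_lt_mul_of_pos_left (hmain B C hC0) hqi
      exact ⟨this.le, fun _ _ => this⟩

end Step

/-! ### The segment in the limiting spectrum -/

section Limit

variable {N : Seminorm ℝ (Fin 2 → ℝ)}

/-- The open conditions on `v` which guarantee that, up to the relative error `ε`, the only best
approximation of `v` with denominator in `[q, (1 - ε) q')` is `(q, p)`, that the next one has
denominator at most `q'`, and that the norm of the corresponding long displacement is about `s`. -/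
structure IsGoodStep (N : Seminorm ℝ (Fin 2 → ℝ)) (s ε : ℝ) (X X' : ApproxBasis)
    (v : Fin 2 → ℝ) : Prop where
  near : |√X'.q * N ((X.q : ℝ) • v - intVec X.p) - s| < ε
  next : N ((X'.q : ℝ) • v - intVec X'.p) < (1 - ε) * N ((X.q : ℝ) • v - intVec X.p)
  le : ∀ k : ℕ, 0 < k → k < X'.q →
    (1 - ε) * N ((X.q : ℝ) • v - intVec X.p) < latticeDist N ((k : ℝ) • v)
  lt : ∀ k : ℕ, 0 < k → (k : ℝ) < (1 - ε) * X'.q → k ≠ X.q →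
    N ((X.q : ℝ) • v - intVec X.p) < latticeDist N ((k : ℝ) • v)

lemma ApproxBasis.exists_next_nhds (hN : ∀ x, N x = 0 → x = 0)
    {a c D : ℝ} (h : IsEllipsoidNormFor N a c D) {s : ℝ} (hs : 0 < s)
    (hsM : s ^ 4 * (D ^ 2 - 1 / 4) < a * c) (X : ApproxBasis) {ε δ : ℝ} (hε : 0 < ε)
    (hε1 : ε < 1) (hδ : 0 < δ) :
    ∃ X' : ApproxBasis, X.q < X'.q ∧ ‖X'.point - X.point‖ < δ ∧
      ∀ᶠ v in 𝓝 X'.point, IsGoodStep N s ε X X' v := by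
  obtain ⟨X', hq, hdist, hnear, hpos, hmin⟩ := X.exists_next hN h hs hsM (lt_min hε hδ)
  have hq'0 : (0 : ℝ) < X'.q := by exact_mod_cast X'.q_pos
  have hqε : (X.q : ℝ) < ε * X'.q :=
    hq.trans_le (mul_le_mul_of_nonneg_right (min_le_left _ _) hq'0.le)
  have hqlt : X.q < X'.q := by
    have : (X.q : ℝ) < X'.q := hqε.trans_le (mul_le_of_le_one_left hq'0.le hε1.le)
    exact_mod_cast this
  refine ⟨X', hqlt, hdist.trans_le (min_le_right _ _), ?_⟩
  have hc := seminorm_continuous N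
  have hl := latticeDist_continuous N
  have hcont : ∀ Z : ApproxBasis, Continuous fun v => N ((Z.q : ℝ) • v - intVec Z.p) :=
    fun Z => hc.comp ((continuous_const_smul _).sub continuous_const)
  have hlcont : ∀ k : ℕ, Continuous fun v => latticeDist N ((k : ℝ) • v) :=
    fun k => hl.comp (continuous_const_smul _)
  have e1 : ∀ᶠ v in 𝓝 X'.point, |√X'.q * N ((X.q : ℝ) • v - intVec X.p) - s| < ε :=
    ((((continuous_const.mul (hcont X)).sub continuous_const).abs).tendsto X'.point).eventually_lt
      tendsto_const_nhds (hnear.trans_le (min_le_left _ _))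
  have e2 : ∀ᶠ v in 𝓝 X'.point,
      N ((X'.q : ℝ) • v - intVec X'.p) < (1 - ε) * N ((X.q : ℝ) • v - intVec X.p) := by
    refine ((hcont X').tendsto X'.point).eventually_lt
      ((continuous_const.mul (hcont X)).tendsto X'.point) ?_
    rw [X'.smul_point, sub_self, map_zero]
    exact mul_pos (by linarith) hpos
  have e3 : ∀ k ∈ Finset.range X'.q, ∀ᶠ v in 𝓝 X'.point, 0 < k →
      (1 - ε) * N ((X.q : ℝ) • v - intVec X.p) < latticeDist N ((k : ℝ) • v) := by
    intro k hk
    rcases Nat.eq_zero_or_pos k with rfl | hk0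
    · simp
    refine (((continuous_const.mul (hcont X)).tendsto X'.point).eventually_lt
      ((hlcont k).tendsto X'.point) ?_).mono fun _ h _ => h
    rw [lt_latticeDist_iff hN]
    intro z
    have := (hmin k z hk0 (Finset.mem_range.1 hk)).1
    change (1 - ε) * N ((X.q : ℝ) • X'.point - intVec X.p) < _
    nlinarith
  have e4 : ∀ k ∈ Finset.range X'.q, ∀ᶠ v in 𝓝 X'.point, 0 < k →
      (k : ℝ) < (1 - ε) * X'.q → k ≠ X.q →
      N ((X.q : ℝ) • v - intVec X.p) < latticeDist N ((k : ℝ) • v) := by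
    intro k hk
    by_cases hcond : 0 < k ∧ (k : ℝ) < (1 - ε) * X'.q ∧ k ≠ X.q
    · refine (((hcont X).tendsto X'.point).eventually_lt
        ((hlcont k).tendsto X'.point) ?_).mono fun _ h _ _ _ => h
      rw [lt_latticeDist_iff hN]
      intro z
      refine (hmin k z hcond.1 (Finset.mem_range.1 hk)).2 hcond.2.2 fun heq => ?_
      have : (k : ℝ) + X.q = X'.q := by exact_mod_cast heq
      linarith [hcond.2.1]
    · exact Eventually.of_forall fun _ h1 h2 h3 => absurd ⟨h1, h2, h3⟩ hcond
  filter_upwards [e1, e2, (Finset.eventually_all _).2 e3, (Finset.eventually_all _).2 e4]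
    with v h1 h2 h3 h4
  refine ⟨h1, h2, fun k hk hk' => h3 k (Finset.mem_range.2 hk') hk,
    fun k hk hk' => h4 k (Finset.mem_range.2 ?_) hk hk'⟩
  have : (k : ℝ) < X'.q := hk'.trans_le (mul_le_of_le_one_left hq'0.le (by linarith))
  exact_mod_cast this

/-- The standard basis of `ℤ³`. -/
def ApproxBasis.std : ApproxBasis where
  q := 1
  p := 0
  qg := 0
  g := ![1, 0]
  qf := 0
  f := ![0, 1]
  q_pos := one_pos
  det_eq := by simp

/-- Nested balls around successive rational points produce a vector `v` all of whose steps are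
good. -/
lemma exists_goodSteps (hN : ∀ x, N x = 0 → x = 0) {a c D : ℝ} (h : IsEllipsoidNormFor N a c D)
    {s ε : ℕ → ℝ} (hs : ∀ n, 0 < s n) (hsM : ∀ n, s n ^ 4 * (D ^ 2 - 1 / 4) < a * c)
    (hε : ∀ n, 0 < ε n) (hε1 : ∀ n, ε n < 1) :
    ∃ (X : ℕ → ApproxBasis) (v : Fin 2 → ℝ), (X 0).q = 1 ∧ (StrictMono fun n => (X n).q) ∧
      ∀ n, IsGoodStep N (s n) (ε n) (X n) (X (n + 1)) v := by
  have hstep : ∀ (n : ℕ) (Z : ApproxBasis × {r : ℝ // 0 < r}),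
      ∃ Z' : ApproxBasis × {r : ℝ // 0 < r}, Z.1.q < Z'.1.q ∧
        Metric.closedBall Z'.1.point Z'.2.1 ⊆ Metric.closedBall Z.1.point Z.2.1 ∧
        ∀ v ∈ Metric.closedBall Z'.1.point Z'.2.1, IsGoodStep N (s n) (ε n) Z.1 Z'.1 v := by
    rintro n ⟨X, r, hr⟩
    obtain ⟨X', hq, hdist, hgood⟩ := X.exists_next_nhds hN h (hs n) (hsM n) (hε n) (hε1 n)
      (half_pos hr)
    obtain ⟨r', hr', hball⟩ := Metric.nhds_basis_closedBall.eventually_iff.1 hgood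
    refine ⟨⟨X', min r' (r / 2), lt_min hr' (half_pos hr)⟩, hq, ?_, fun v hv => ?_⟩
    · refine Metric.closedBall_subset_closedBall' ?_
      rw [dist_eq_norm]
      have := min_le_right r' (r / 2)
      simp only
      linarith
    · exact hball (Metric.closedBall_subset_closedBall (min_le_left _ _) hv)
  choose F hF using hstep
  let Z : ℕ → ApproxBasis × {r : ℝ // 0 < r} :=
    fun n => Nat.rec (ApproxBasis.std, ⟨1, one_pos⟩) F n
  have hZ : ∀ n, Z (n + 1) = F n (Z n) := fun n => rfl
  obtain ⟨v, hv⟩ := IsCompact.nonempty_iInter_of_sequence_nonempty_isCompact_isClosed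
    (fun n => Metric.closedBall (Z n).1.point (Z n).2.1)
    (fun n => by rw [hZ]; exact (hF n (Z n)).2.1)
    (fun n => Metric.nonempty_closedBall.2 (Z n).2.2.le)
    (isCompact_closedBall _ _) (fun n => Metric.isClosed_closedBall)
  rw [mem_iInter] at hv
  refine ⟨fun n => (Z n).1, v, rfl, strictMono_nat_of_lt_succ fun n => ?_, fun n => ?_⟩
  · change (Z n).1.q < (F n (Z n)).1.q
    exact (hF n (Z n)).1
  · have h1 := hv (n + 1)
    rw [hZ] at h1
    exact (hF n (Z n)).2.2 v h1

lemma ellipsoidValue_pos {a c D : ℝ} (ha : 0 < a) (hc : 0 < c) (hD : 1 ≤ D) :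
    0 < ellipsoidValue a c D := by
  have : 0 < 4 * D ^ 2 - 1 := by nlinarith
  unfold ellipsoidValue
  positivity

lemma ellipsoidValue_pow_four {a c D : ℝ} (ha : 0 ≤ a) (hc : 0 ≤ c) (hD : 1 ≤ D) :
    ellipsoidValue a c D ^ 4 = 4 * a * c / (4 * D ^ 2 - 1) := by
  have : 0 < 4 * D ^ 2 - 1 := by nlinarith
  rw [ellipsoidValue, ← Real.rpow_natCast, ← Real.rpow_mul (by positivity)]
  norm_num

/-- Every value up to `ellipsoidValue a c D` is the limit of the norms of the long displacements
for a suitable vector. -/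
theorem Icc_subset_limitingDirichletSpectrum (hN : ∀ x, N x = 0 → x = 0) {a c D : ℝ}
    (h : IsEllipsoidNormFor N a c D) :
    Icc 0 (ellipsoidValue a c D) ⊆ limitingDirichletSpectrum N := by
  obtain ⟨ha, hc, hD, -⟩ := id h
  intro σ hσ
  have hM := ellipsoidValue_pos ha hc hD
  have hM4 := ellipsoidValue_pow_four ha.le hc.le hD
  set M := ellipsoidValue a c D with hMdef
  set ε : ℕ → ℝ := fun n => 1 / ((n + 1 : ℕ) + 1 : ℝ) with hε
  have hε0 : ∀ n, 0 < ε n := fun n => by positivity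
  have hε1 : ∀ n, ε n < 1 := fun n => by
    rw [hε]
    simp only
    rw [div_lt_one (by positivity)]
    push_cast
    linarith [(Nat.cast_nonneg n : (0 : ℝ) ≤ n)]
  have hεlim : Tendsto ε atTop (𝓝 0) :=
    (tendsto_one_div_add_atTop_nhds_zero_nat (𝕜 := ℝ)).comp (tendsto_add_atTop_nat 1)
  -- targets strictly inside the segment
  set s : ℕ → ℝ := fun n => (1 - ε n) * σ + ε n * (M / 2) with hs
  have hs0 : ∀ n, 0 < s n := fun n =>
    add_pos_of_nonneg_of_pos (mul_nonneg (by linarith [hε1 n]) hσ.1)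
      (mul_pos (hε0 n) (by linarith))
  have hsM : ∀ n, s n < M := fun n => by
    have h1 : (1 - ε n) * σ ≤ (1 - ε n) * M :=
      mul_le_mul_of_nonneg_left hσ.2 (by linarith [hε1 n])
    have h2 : 0 < ε n * M := mul_pos (hε0 n) hM
    simp only [hs]
    linarith
  have hslim : Tendsto s atTop (𝓝 σ) := by
    have h1 := ((hεlim.const_sub 1).mul_const σ).add (hεlim.mul_const (M / 2))
    rwa [sub_zero, one_mul, zero_mul, add_zero] at h1
  have hsM4 : ∀ n, s n ^ 4 * (D ^ 2 - 1 / 4) < a * c := fun n => by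
    have h1 : s n ^ 4 < M ^ 4 := pow_lt_pow_left₀ (hsM n) (hs0 n).le (by norm_num)
    rw [hM4, lt_div_iff₀ (by nlinarith)] at h1
    linarith
  obtain ⟨X, v, hX0, hXm, hgood⟩ := exists_goodSteps hN h hs0 hsM4 hε0 hε1
  set x : ℕ → ℝ := fun n => N (((X n).q : ℝ) • v - intVec (X n).p) with hx
  have hx0 : ∀ n, 0 ≤ x n := fun n => apply_nonneg N _
  have hdx : ∀ n, latticeDist N (((X n).q : ℝ) • v) ≤ x n := fun n => latticeDist_le N _ _
  -- the block `[q_n, q_{n+1})` containing a given integer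
  have hblock : ∀ k : ℕ, 1 ≤ k → ∃ n, (X n).q ≤ k ∧ k < (X (n + 1)).q := by
    intro k hk
    have hex : ∃ n, k < (X n).q := ⟨k + 1, (Nat.lt_succ_self k).trans_le (hXm.id_le (k + 1))⟩
    have hne : Nat.find hex ≠ 0 := fun h0 => by
      have := Nat.find_spec hex
      rw [h0, hX0] at this
      omega
    obtain ⟨n, hn⟩ := Nat.exists_eq_succ_of_ne_zero hne
    refine ⟨n, not_lt.1 (Nat.find_min hex (by omega)), ?_⟩
    have := Nat.find_spec hex
    rwa [hn] at this
  have hlow : ∀ n k : ℕ, 1 ≤ k → k < (X (n + 1)).q →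
      latticeDist N (((X (n + 1)).q : ℝ) • v) < latticeDist N ((k : ℝ) • v) :=
    fun n k hk hkn => ((hdx (n + 1)).trans_lt (hgood n).next).trans ((hgood n).le k hk hkn)
  have hirr : NotRationalVec v := by
    rintro ⟨r, hr⟩
    -- a common denominator would put a multiple of `v` in the lattice
    obtain ⟨n, -, hn⟩ := hblock ((r 0).den * (r 1).den) (Nat.mul_pos (r 0).pos (r 1).pos)
    have h1 := (latticeDist_nonneg N _).trans_lt
      (hlow n _ (Nat.mul_pos (r 0).pos (r 1).pos) hn)
    refine absurd h1 (not_lt.2 ?_)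
    refine (latticeDist_le N _ ![(r 0).num * (r 1).den, (r 1).num * (r 0).den]).trans ?_
    have h0 : (((r 0).den * (r 1).den : ℕ) : ℝ) • v -
        intVec ![(r 0).num * (r 1).den, (r 1).num * (r 0).den] = 0 := by
      have e0 : ((r 0).den : ℝ) * (r 0 : ℝ) = (r 0).num := by
        exact_mod_cast Rat.den_mul_eq_num (r 0)
      have e1 : ((r 1).den : ℝ) * (r 1 : ℝ) = (r 1).num := by
        exact_mod_cast Rat.den_mul_eq_num (r 1)
      ext i
      rw [hr]
      fin_cases i
      · simp [intVec]
        linear_combination ((r 1).den : ℝ) * e0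
      · simp [intVec]
        linear_combination ((r 0).den : ℝ) * e1
    rw [h0, map_zero]
  obtain ⟨Q, P, hQ⟩ := exists_isBestApproxSeq hN v fun k hk => by
    obtain ⟨n, -, hn⟩ := hblock k hk
    exact ⟨_, (X (n + 1)).q_pos, hlow n k hk hn⟩
  refine ⟨v, hirr, Q, P, hQ, ?_⟩
  choose b hb1 hb2 using fun k => hblock (Q k) (hQ.one_le k)
  have hb : Tendsto b atTop atTop := by
    refine tendsto_atTop.2 fun n => ?_
    filter_upwards [hQ.strictMono.tendsto_atTop.eventually_ge_atTop (X n).q] with k hk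
    exact Nat.lt_succ_iff.1 (hXm.lt_iff_lt.1 (hk.trans_lt (hb2 k)))
  have hup : Tendsto (fun n => s n + ε n) atTop (𝓝 σ) := by
    have h1 := hslim.add hεlim
    rwa [add_zero] at h1
  have hdown : Tendsto (fun n => (1 - ε n) ^ 2 * (s n - ε n)) atTop (𝓝 σ) := by
    have h1 := ((hεlim.const_sub 1).pow 2).mul (hslim.sub hεlim)
    rwa [sub_zero, sub_zero, one_pow, one_mul] at h1
  refine tendsto_of_tendsto_of_tendsto_of_le_of_le (hdown.comp hb) (hup.comp hb)
    (fun k => ?_) (fun k => ?_)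
  all_goals
    simp only [Function.comp]
    rw [hQ.seminorm_longDisplacement, Nat.cast_ofNat, ← Real.sqrt_eq_rpow]
    have hnear := abs_lt.1 (hgood (b k)).near
    have hqk : latticeDist N ((Q k : ℝ) • v) ≤ x (b k) := by
      refine le_trans ?_ (hdx (b k))
      exact hQ.latticeDist_le k (X (b k)).q_pos
        ((hb1 k).trans_lt (hQ.strictMono k.lt_succ_self))
  · have h1 : (1 - ε (b k)) * (X (b k + 1)).q ≤ Q (k + 1) := by
      by_contra! hlt
      have h2 := (hgood (b k)).lt (Q (k + 1)) (hQ.one_le _) hlt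
        ((hb1 k).trans_lt (hQ.strictMono k.lt_succ_self)).ne'
      exact absurd (h2.trans (hQ.latticeDist_lt k)) (not_lt.2 hqk)
    have h2 := (hgood (b k)).le (Q k) (hQ.one_le k) (hb2 k)
    have h3 : 0 < 1 - ε (b k) := by linarith [hε1 (b k)]
    have h4 : (1 - ε (b k)) * √(X (b k + 1)).q ≤ √(Q (k + 1)) := by
      refine Real.le_sqrt_of_sq_le ?_
      rw [mul_pow, Real.sq_sqrt (by positivity)]
      refine le_trans (mul_le_mul_of_nonneg_right ?_ (by positivity)) h1
      nlinarith [hε0 (b k)]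
    calc (1 - ε (b k)) ^ 2 * (s (b k) - ε (b k))
        ≤ (1 - ε (b k)) ^ 2 * (√(X (b k + 1)).q * x (b k)) :=
          mul_le_mul_of_nonneg_left (by simp only [hx]; linarith [hnear.1]) (by positivity)
      _ = ((1 - ε (b k)) * √(X (b k + 1)).q) * ((1 - ε (b k)) * x (b k)) := by ring
      _ ≤ √(Q (k + 1)) * latticeDist N ((Q k : ℝ) • v) :=
          mul_le_mul h4 h2.le (mul_nonneg h3.le (hx0 _)) (Real.sqrt_nonneg _)
  · have h1 : Q (k + 1) ≤ (X (b k + 1)).q :=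
      (hQ.isLeast k).2 ⟨(X (b k + 1)).q_pos, hlow (b k) (Q k) (hQ.one_le k) (hb2 k)⟩
    calc √(Q (k + 1)) * latticeDist N ((Q k : ℝ) • v)
        ≤ √(X (b k + 1)).q * x (b k) :=
          mul_le_mul (Real.sqrt_le_sqrt (by exact_mod_cast h1)) hqk (latticeDist_nonneg N _)
            (Real.sqrt_nonneg _)
      _ ≤ s (b k) + ε (b k) := by simp only [hx]; linarith [hnear.2]

end Limit

/-! ### Best ellipsoid norms -/

section BestEllipsoid

variable {N : Seminorm ℝ (Fin 2 → ℝ)}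

lemma ellipseNorm_le_iff {a c : ℝ} {u : Fin 2 → ℝ} {r : ℝ} (hr : 0 ≤ r) :
    ellipseNorm a c u ≤ r ↔ a * u 0 ^ 2 + c * u 1 ^ 2 ≤ r ^ 2 := Real.sqrt_le_left hr

lemma le_mul_ellipseNorm_iff {a c D : ℝ} (ha : 0 ≤ a) (hc : 0 ≤ c) (hD : 0 ≤ D)
    {u : Fin 2 → ℝ} {r : ℝ} (hr : 0 ≤ r) :
    r ≤ D * ellipseNorm a c u ↔ r ^ 2 ≤ D ^ 2 * (a * u 0 ^ 2 + c * u 1 ^ 2) := by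
  have h : D ^ 2 * (a * u 0 ^ 2 + c * u 1 ^ 2) = (D * ellipseNorm a c u) ^ 2 := by
    rw [mul_pow, ellipseNorm, Real.sq_sqrt (by positivity)]
  rw [h, pow_le_pow_iff_left₀ hr (mul_nonneg hD (ellipseNorm_nonneg _ _ _)) two_ne_zero]

lemma IsEllipsoidNormFor.sq_bounds {a c D : ℝ} (h : IsEllipsoidNormFor N a c D)
    (u : Fin 2 → ℝ) : a * u 0 ^ 2 + c * u 1 ^ 2 ≤ N u ^ 2 ∧
      N u ^ 2 ≤ D ^ 2 * (a * u 0 ^ 2 + c * u 1 ^ 2) :=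
  ⟨(ellipseNorm_le_iff (apply_nonneg N u)).1 (h.2.2.2 u).1,
    (le_mul_ellipseNorm_iff h.1.le h.2.1.le (zero_le_one.trans h.2.2.1) (apply_nonneg N u)).1
      (h.2.2.2 u).2⟩

lemma exists_isEllipsoidNormFor (hN : ∀ x, N x = 0 → x = 0) :
    ∃ a c D : ℝ, IsEllipsoidNormFor N a c D := by
  obtain ⟨κ, hκ, hlow⟩ := exists_mul_norm_le_seminorm hN
  obtain ⟨K, hK, hup⟩ := seminorm_le_mul_norm N
  have hnorm : ∀ u : Fin 2 → ℝ, u 0 ^ 2 + u 1 ^ 2 ≤ 2 * ‖u‖ ^ 2 ∧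
      ‖u‖ ^ 2 ≤ u 0 ^ 2 + u 1 ^ 2 := by
    intro u
    have h0 : |u 0| ≤ ‖u‖ := norm_le_pi_norm u 0
    have h1 : |u 1| ≤ ‖u‖ := norm_le_pi_norm u 1
    have h3 : ‖u‖ ≤ √(u 0 ^ 2 + u 1 ^ 2) := by
      refine (pi_norm_le_iff_of_nonneg (Real.sqrt_nonneg _)).2 fun i => ?_
      fin_cases i <;> refine Real.le_sqrt_of_sq_le ?_ <;>
        simp [sq_abs, sq_nonneg]
    have h4 := pow_le_pow_left₀ (norm_nonneg u) h3 2
    rw [Real.sq_sqrt (by positivity)] at h4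
    exact ⟨by nlinarith [sq_abs (u 0), sq_abs (u 1), abs_nonneg (u 0), abs_nonneg (u 1)], h4⟩
  refine ⟨κ ^ 2 / 2, κ ^ 2 / 2, 1 + 2 * (K / κ), by positivity, by positivity, ?_, fun u =>
    ⟨(ellipseNorm_le_iff (apply_nonneg N u)).2 ?_,
      (le_mul_ellipseNorm_iff (by positivity) (by positivity) (by positivity)
        (apply_nonneg N u)).2 ?_⟩⟩
  · have : 0 < K / κ := by positivity
    linarith
  · have := pow_le_pow_left₀ (by positivity) (hlow u) 2
    nlinarith [(hnorm u).1]
  · have h1 := pow_le_pow_left₀ (apply_nonneg N u) (hup u) 2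
    have h2 : (2 * (K / κ)) ^ 2 ≤ (1 + 2 * (K / κ)) ^ 2 :=
      pow_le_pow_left₀ (by positivity) (by linarith) 2
    calc N u ^ 2 ≤ K ^ 2 * ‖u‖ ^ 2 := by rwa [mul_pow] at h1
      _ ≤ K ^ 2 * (2 * (u 0 ^ 2 + u 1 ^ 2)) := by
        gcongr
        nlinarith [(hnorm u).2, sq_nonneg ‖u‖]
      _ = (2 * (K / κ)) ^ 2 * (κ ^ 2 / 2 * u 0 ^ 2 + κ ^ 2 / 2 * u 1 ^ 2) := by
        field_simp
      _ ≤ _ := mul_le_mul_of_nonneg_right h2 (by positivity)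

lemma ellipsoidValue_le_iff {a c D a' c' D' : ℝ} (ha : 0 ≤ a) (hc : 0 ≤ c) (hD : 1 ≤ D)
    (ha' : 0 ≤ a') (hc' : 0 ≤ c') (hD' : 1 ≤ D') :
    ellipsoidValue a c D ≤ ellipsoidValue a' c' D' ↔
      4 * a * c / (4 * D ^ 2 - 1) ≤ 4 * a' * c' / (4 * D' ^ 2 - 1) := by
  have h1 : 0 < 4 * D ^ 2 - 1 := by nlinarith
  have h2 : 0 < 4 * D' ^ 2 - 1 := by nlinarith
  exact Real.rpow_le_rpow_iff (by positivity) (by positivity) (by norm_num)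

/-- The parameters whose value is not below a given one form a compact set, since a large
distortion makes the value small; so the value attains its maximum. -/
theorem exists_isBestEllipsoidNormFor (hN : ∀ x, N x = 0 → x = 0) :
    ∃ a c D : ℝ, IsBestEllipsoidNormFor N a c D := by
  obtain ⟨a₀, c₀, D₀, h₀⟩ := exists_isEllipsoidNormFor hN
  set F : ℝ × ℝ × ℝ → ℝ := fun x => 4 * x.1 * x.2.1 / (4 * x.2.2 ^ 2 - 1) with hF
  set F₀ := F (a₀, c₀, D₀) with hF₀
  have hden : ∀ D : ℝ, 1 ≤ D → 0 < 4 * D ^ 2 - 1 := fun D hD => by nlinarith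
  have hF₀pos : 0 < F₀ :=
    div_pos (mul_pos (mul_pos four_pos h₀.1) h₀.2.1) (hden _ h₀.2.2.1)
  set A := N ![1, 0] ^ 2 with hA
  set C := N ![0, 1] ^ 2 with hC
  set S : Set (ℝ × ℝ × ℝ) := Icc (0, 0, 1) (A, C, 4 * A * C / (3 * F₀)) ∩
    {x | ∀ u, ellipseNorm x.1 x.2.1 u ≤ N u ∧ N u ≤ x.2.2 * ellipseNorm x.1 x.2.1 u} with hS
  have hmem : ∀ a c D, IsEllipsoidNormFor N a c D → F₀ ≤ F (a, c, D) → (a, c, D) ∈ S := by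
    intro a c D h hle
    have h1 := (h.sq_bounds ![1, 0]).1
    have h2 := (h.sq_bounds ![0, 1]).1
    simp at h1 h2
    refine ⟨⟨⟨h.1.le, h.2.1.le, h.2.2.1⟩, h1, h2, ?_⟩, h.2.2.2⟩
    have hD := h.2.2.1
    rw [le_div_iff₀ (by positivity)]
    simp only [hF] at hle
    rw [le_div_iff₀ (hden D hD)] at hle
    calc D * (3 * F₀) ≤ F₀ * (4 * D ^ 2 - 1) := by
          have h3 : 3 * D ≤ 4 * D ^ 2 - 1 := by nlinarith
          linarith [mul_le_mul_of_nonneg_left h3 hF₀pos.le]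
      _ ≤ 4 * a * c := hle
      _ ≤ 4 * A * C := by
        have := mul_le_mul h1 h2 h.2.1.le (by positivity)
        linarith
  have hScomp : IsCompact S := by
    refine isCompact_Icc.inter_right ?_
    have h1 : ∀ u : Fin 2 → ℝ, Continuous fun x : ℝ × ℝ × ℝ => ellipseNorm x.1 x.2.1 u := by
      intro u
      unfold ellipseNorm
      fun_prop
    simp only [ofPred_forall]
    exact isClosed_iInter fun u => (isClosed_le (h1 u) continuous_const).inter
      (isClosed_le continuous_const (continuous_snd.snd.mul (h1 u)))
  have hFc : ContinuousOn F S := by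
    refine ContinuousOn.div (by fun_prop) (by fun_prop) fun x hx => ?_
    exact (hden _ hx.1.1.2.2).ne'
  obtain ⟨⟨a, c, D⟩, hx, hmax⟩ := hScomp.exists_isMaxOn ⟨_, hmem _ _ _ h₀ le_rfl⟩ hFc
  have hge : F₀ ≤ F (a, c, D) := hmax (hmem _ _ _ h₀ le_rfl)
  have ha : 0 ≤ a := hx.1.1.1
  have hc : 0 ≤ c := hx.1.1.2.1
  have hD : 1 ≤ D := hx.1.1.2.2
  have hac : 0 < 4 * a * c := by
    have h1 := hF₀pos.trans_le hge
    simp only [hF] at h1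
    exact (div_pos_iff_of_pos_right (hden D hD)).1 h1
  have ha' : 0 < a := lt_of_le_of_ne ha fun h => by simp [← h] at hac
  have hc' : 0 < c := lt_of_le_of_ne hc fun h => by simp [← h] at hac
  refine ⟨a, c, D, ⟨ha', hc', hD, hx.2⟩, fun a' c' D' h' => ?_⟩
  rw [ellipsoidValue_le_iff h'.1.le h'.2.1.le h'.2.2.1 ha hc hD]
  rcases le_total F₀ (F (a', c', D')) with hle | hle
  · exact hmax (hmem _ _ _ h' hle)
  · exact hle.trans hge

lemma IsEllipsoidNormFor.isBest {a c D : ℝ} (h : IsEllipsoidNormFor N a c D)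
    (hbest : ∀ a' c' D', IsEllipsoidNormFor N a' c' D' → a' * c' ≤ a * c ∧ D ^ 2 ≤ D' ^ 2) :
    IsBestEllipsoidNormFor N a c D := by
  refine ⟨h, fun a' c' D' h' => ?_⟩
  obtain ⟨h1, h2⟩ := hbest a' c' D' h'
  have hD := h.2.2.1
  have := h.1
  have := h.2.1
  rw [ellipsoidValue_le_iff h'.1.le h'.2.1.le h'.2.2.1 h.1.le h.2.1.le hD]
  refine div_le_div₀ (by positivity) (by linarith) (by nlinarith) (by linarith)

/-- An ellipse norm is its own best ellipsoid norm. -/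
lemma isBestEllipsoidNormFor_self {a c : ℝ} (ha : 0 < a) (hc : 0 < c)
    (hNu : ∀ u, N u = √(a * u 0 ^ 2 + c * u 1 ^ 2)) : IsBestEllipsoidNormFor N a c 1 := by
  refine IsEllipsoidNormFor.isBest ⟨ha, hc, le_rfl, fun u => ?_⟩ fun a' c' D' h' => ?_
  · rw [hNu, one_mul]
    exact ⟨le_rfl, le_rfl⟩
  · have h1 := (h'.sq_bounds ![1, 0]).1
    have h2 := (h'.sq_bounds ![0, 1]).1
    rw [hNu, Real.sq_sqrt (by positivity)] at h1 h2
    simp at h1 h2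
    have hD := h'.2.2.1
    exact ⟨mul_le_mul h1 h2 h'.2.1.le ha.le, by nlinarith⟩

/-- The values of a norm at `(1, 0)`, `(0, 1)` and `(1, 1)` restrict its ellipsoid norms. -/
lemma IsEllipsoidNormFor.bounds_of_symm {a c D α β : ℝ} (h : IsEllipsoidNormFor N a c D)
    (h10 : N ![1, 0] = α) (h01 : N ![0, 1] = α) (h11 : N ![1, 1] = β) :
    a * c ≤ (α ^ 2) ^ 2 ∧ 4 * (a * c) ≤ (β ^ 2) ^ 2 ∧ 2 * α ^ 2 ≤ D ^ 2 * β ^ 2 ∧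
      β ^ 2 ≤ D ^ 2 * (2 * α ^ 2) := by
  have h1 := h.sq_bounds ![1, 0]
  have h2 := h.sq_bounds ![0, 1]
  have h3 := h.sq_bounds ![1, 1]
  rw [h10] at h1
  rw [h01] at h2
  rw [h11] at h3
  simp at h1 h2 h3
  have ha := h.1
  have hc := h.2.1
  have hD : 0 ≤ D ^ 2 := sq_nonneg D
  refine ⟨?_, ?_, ?_, ?_⟩
  · rw [sq (α ^ 2)]
    exact mul_le_mul h1.1 h2.1 hc.le (by positivity)
  · nlinarith [sq_nonneg (a - c), pow_le_pow_left₀ (by positivity) h3.1 2]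
  · nlinarith [mul_le_mul_of_nonneg_left h3.1 hD]
  · nlinarith [mul_le_mul_of_nonneg_left h1.1 hD, mul_le_mul_of_nonneg_left h2.1 hD]

lemma hasBestEllipsoidSegment_of_isBest (hN : ∀ x, N x = 0 → x = 0) {a c D M : ℝ}
    (h : IsBestEllipsoidNormFor N a c D) (hM0 : 0 ≤ M) (hM : M ^ 4 = 4 * a * c / (4 * D ^ 2 - 1)) :
    HasBestEllipsoidSegment N a c D M := by
  have hval : ellipsoidValue a c D = M := by
    rw [← ellipsoidValue_pow_four h.1.1.le h.1.2.1.le h.1.2.2.1] at hM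
    exact ((pow_left_inj₀ hM0 (ellipsoidValue_pos h.1.1 h.1.2.1 h.1.2.2.1).le (by norm_num)).1 hM).symm
  refine ⟨h, hval, ?_, limitingDirichletSpectrum_subset N⟩
  rw [← hval]
  exact Icc_subset_limitingDirichletSpectrum hN h.1

end BestEllipsoid

/-! ### The Euclidean norm, the maximum norm and the `p`-norms -/

section Examples

variable {N : Seminorm ℝ (Fin 2 → ℝ)}

lemma ellipse_definite {a c : ℝ} (ha : 0 < a) (hc : 0 < c)
    (hNu : ∀ u, N u = √(a * u 0 ^ 2 + c * u 1 ^ 2)) : ∀ x, N x = 0 → x = 0 := by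
  intro x hx
  by_contra hne
  have h1 := ellipseInner_self_pos ha hc hne
  have h2 : ellipseNorm a c x = 0 := (hNu x).symm.trans hx
  rw [← ellipseNorm_sq ha hc, h2] at h1
  norm_num at h1

lemma hasBestEllipsoidSegment_ellipse {a c : ℝ} (ha : 0 < a) (hc : 0 < c)
    (hNu : ∀ u, N u = √(a * u 0 ^ 2 + c * u 1 ^ 2)) :
    HasBestEllipsoidSegment N a c 1 (ellipsoidValue a c 1) :=
  hasBestEllipsoidSegment_of_isBest (ellipse_definite ha hc hNu)
    (isBestEllipsoidNormFor_self ha hc hNu) (ellipsoidValue_pos ha hc le_rfl).le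
    (ellipsoidValue_pow_four ha.le hc.le le_rfl)

lemma hasBestEllipsoidSegment_euclidean (hNu : ∀ u, N u = √(u 0 ^ 2 + u 1 ^ 2)) :
    HasBestEllipsoidSegment N 1 1 1 (√(2 / √3)) := by
  have h := hasBestEllipsoidSegment_ellipse (N := N) one_pos one_pos
    (fun u => by rw [hNu, one_mul, one_mul])
  have hval : √(2 / √3) = ellipsoidValue 1 1 1 := by
    refine (pow_left_inj₀ (Real.sqrt_nonneg _) (ellipsoidValue_pos one_pos one_pos le_rfl).le
      (four_ne_zero)).1 ?_
    rw [ellipsoidValue_pow_four zero_le_one zero_le_one le_rfl,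
      show √(2 / √3) ^ 4 = (√(2 / √3) ^ 2) ^ 2 by ring, Real.sq_sqrt (by positivity), div_pow,
      Real.sq_sqrt (by norm_num)]
    norm_num
  rwa [hval]

lemma hasBestEllipsoidSegment_max (hNu : ∀ u, N u = max |u 0| |u 1|) :
    HasBestEllipsoidSegment N (1 / 2) (1 / 2) (√2) ((7 : ℝ) ^ (-1 / 4 : ℝ)) := by
  have hN : ∀ x, N x = 0 → x = 0 := by
    intro x hx
    rw [hNu] at hx
    have h0 : |x 0| ≤ 0 := hx ▸ le_max_left _ _
    have h1 : |x 1| ≤ 0 := hx ▸ le_max_right _ _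
    ext i
    fin_cases i
    · exact abs_nonpos_iff.1 h0
    · exact abs_nonpos_iff.1 h1
  have h2 : √(2 : ℝ) ^ 2 = 2 := Real.sq_sqrt (by norm_num)
  refine hasBestEllipsoidSegment_of_isBest hN (IsEllipsoidNormFor.isBest
    ⟨by norm_num, by norm_num, Real.one_le_sqrt.2 (by norm_num), fun u => ?_⟩
    fun a' c' D' h' => ?_) (by positivity) ?_
  · rw [ellipseNorm_le_iff (apply_nonneg N u), le_mul_ellipseNorm_iff (by norm_num) (by norm_num)
      (Real.sqrt_nonneg _) (apply_nonneg N u), hNu, h2, ← sq_abs (u 0), ← sq_abs (u 1)]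
    rcases le_total |u 0| |u 1| with h | h
    · rw [max_eq_right h]
      constructor <;> nlinarith [abs_nonneg (u 0), abs_nonneg (u 1)]
    · rw [max_eq_left h]
      constructor <;> nlinarith [abs_nonneg (u 0), abs_nonneg (u 1)]
  · obtain ⟨h3, h4, h5, h6⟩ := h'.bounds_of_symm (α := 1) (β := 1) (by simp [hNu]) (by simp [hNu])
      (by simp [hNu])
    rw [h2]
    constructor <;> linarith
  · rw [h2, ← Real.rpow_natCast, ← Real.rpow_mul (by norm_num)]
    norm_num [Real.rpow_neg_one]

/-- Between two `p`-norms on the plane the distortion is that of the vectors `(1, 1)`. -/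
lemma rpow_add_rpow_le_two_rpow_mul {p q x y : ℝ} (hx : 0 ≤ x) (hy : 0 ≤ y) (hp : 0 < p)
    (hpq : p ≤ q) : (x ^ p + y ^ p) ^ (1 / p) ≤
      2 ^ (1 / p - 1 / q) * (x ^ q + y ^ q) ^ (1 / q) := by
  have hq : 0 < q := hp.trans_le hpq
  have h : (x ^ p + y ^ p) ^ (q / p) ≤ 2 ^ (q / p - 1) * (x ^ q + y ^ q) := by
    lift x to NNReal using hx
    lift y to NNReal using hy
    have h1 := NNReal.rpow_add_le_mul_rpow_add_rpow (x ^ p) (y ^ p)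
      ((one_le_div hp).2 hpq)
    rw [← NNReal.rpow_mul, ← NNReal.rpow_mul, mul_div_cancel₀ _ hp.ne'] at h1
    exact_mod_cast h1
  have h2 := Real.rpow_le_rpow (by positivity) h (show 0 ≤ 1 / q by positivity)
  rw [Real.mul_rpow (by positivity) (by positivity), ← Real.rpow_mul (by positivity),
    ← Real.rpow_mul (by positivity)] at h2
  convert h2 using 2
  · field_simp
  · congr 1
    field_simp

section PNorm

variable {p : ℝ}

lemma pnorm_definite (hp : 0 < p) (hNu : ∀ u, N u = (|u 0| ^ p + |u 1| ^ p) ^ (1 / p)) :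
    ∀ x, N x = 0 → x = 0 := by
  intro x hx
  have h0 : 0 ≤ |x 0| ^ p := by positivity
  have h1 : 0 ≤ |x 1| ^ p := by positivity
  rw [hNu, Real.rpow_eq_zero (by positivity) (by positivity)] at hx
  have h2 : |x 0| ^ p = 0 := by linarith
  have h3 : |x 1| ^ p = 0 := by linarith
  rw [Real.rpow_eq_zero (abs_nonneg _) hp.ne', abs_eq_zero] at h2 h3
  ext i
  fin_cases i
  · exact h2
  · exact h3

lemma pnorm_values (hp : 0 < p) (hNu : ∀ u, N u = (|u 0| ^ p + |u 1| ^ p) ^ (1 / p)) :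
    N ![1, 0] = 1 ∧ N ![0, 1] = 1 ∧ N ![1, 1] = 2 ^ (1 / p) := by
  simp [hNu, Real.zero_rpow hp.ne']
  norm_num

lemma two_rpow_sq (x : ℝ) : ((2 : ℝ) ^ x) ^ 2 = 2 ^ (2 * x) := by
  rw [← Real.rpow_natCast, ← Real.rpow_mul (by norm_num), mul_comm, Nat.cast_ofNat]

lemma euclid_eq (u : Fin 2 → ℝ) :
    √(u 0 ^ 2 + u 1 ^ 2) = (|u 0| ^ (2 : ℝ) + |u 1| ^ (2 : ℝ)) ^ (1 / 2 : ℝ) := by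
  simp [Real.sqrt_eq_rpow, sq_abs]

lemma ellipseNorm_self {a : ℝ} (ha : 0 ≤ a) (u : Fin 2 → ℝ) :
    ellipseNorm a a u = √a * √(u 0 ^ 2 + u 1 ^ 2) := by
  rw [ellipseNorm, ← mul_add, Real.sqrt_mul ha]

lemma hasBestEllipsoidSegment_pnorm_of_two_lt (hp : 2 < p)
    (hNu : ∀ u, N u = (|u 0| ^ p + |u 1| ^ p) ^ (1 / p)) :
    HasBestEllipsoidSegment N ((2 : ℝ) ^ (2 / p - 1)) ((2 : ℝ) ^ (2 / p - 1))
      ((2 : ℝ) ^ (1 / 2 - 1 / p))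
      ((8 : ℝ) ^ (1 / (2 * p)) * (8 - (4 : ℝ) ^ (1 / p)) ^ (-1 / 4 : ℝ)) := by
  have hp0 : 0 < p := by linarith
  obtain ⟨h10, h01, h11⟩ := pnorm_values hp0 hNu
  have hinv : 1 / p < 1 / 2 := one_div_lt_one_div_of_lt (by norm_num) hp
  have h4 : (4 : ℝ) ^ (1 / p) = 2 ^ (2 / p) := by
    rw [show (4 : ℝ) = 2 ^ (2 : ℝ) by norm_num, ← Real.rpow_mul (by norm_num)]
    congr 1
    ring
  have hlt : (2 : ℝ) ^ (2 / p) < 2 := by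
    conv_rhs => rw [← Real.rpow_one 2]
    refine Real.rpow_lt_rpow_of_exponent_lt (by norm_num) ?_
    rw [div_lt_one hp0]
    exact hp
  have hpos : (0 : ℝ) < 2 ^ (2 / p) := by positivity
  have hDsq : ((2 : ℝ) ^ (1 / 2 - 1 / p)) ^ 2 = 2 / 2 ^ (2 / p) := by
    rw [two_rpow_sq, show 2 * (1 / 2 - 1 / p) = 1 - 2 / p by ring, Real.rpow_sub (by norm_num),
      Real.rpow_one]
  have ha : (2 : ℝ) ^ (2 / p - 1) = 2 ^ (2 / p) / 2 := by
    rw [Real.rpow_sub (by norm_num), Real.rpow_one]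
  have hsqrt : √((2 : ℝ) ^ (2 / p - 1)) * 2 ^ (1 / 2 - 1 / p) = 1 := by
    refine (pow_left_inj₀ (by positivity) (by norm_num) (two_ne_zero)).1 ?_
    rw [mul_pow, Real.sq_sqrt (by positivity), ha, hDsq]
    field_simp
  refine hasBestEllipsoidSegment_of_isBest (pnorm_definite hp0 hNu) (IsEllipsoidNormFor.isBest
    ⟨by positivity, by positivity, Real.one_le_rpow (by norm_num) (by linarith), fun u => ?_⟩
    fun a' c' D' h' => ?_) (mul_nonneg (by positivity) (Real.rpow_nonneg (by linarith) _)) ?_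
  · rw [ellipseNorm_self (by positivity), ← mul_assoc, mul_comm (2 ^ (1 / 2 - 1 / p) : ℝ), hsqrt,
      one_mul, euclid_eq, hNu]
    refine ⟨?_, Real.rpow_add_rpow_le (abs_nonneg _) (abs_nonneg _) (by norm_num) hp.le⟩
    have h1 := rpow_add_rpow_le_two_rpow_mul (abs_nonneg (u 0)) (abs_nonneg (u 1)) two_pos hp.le
    refine (mul_le_mul_of_nonneg_left h1 (Real.sqrt_nonneg _)).trans ?_
    rw [← mul_assoc, hsqrt, one_mul]
  · obtain ⟨h3, h5, h6, h7⟩ := h'.bounds_of_symm h10 h01 h11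
    rw [two_rpow_sq, mul_one_div] at h5 h6
    rw [hDsq, ha, div_le_iff₀ hpos]
    constructor <;> nlinarith
  · rw [mul_pow, hDsq, ha, h4, ← Real.rpow_natCast, ← Real.rpow_natCast,
      ← Real.rpow_mul (by norm_num), ← Real.rpow_mul (by linarith)]
    have h8 : (8 : ℝ) ^ (1 / (2 * p) * (4 : ℕ)) = (2 ^ (2 / p)) ^ 3 := by
      rw [show (8 : ℝ) = 2 ^ (3 : ℝ) by norm_num, ← Real.rpow_mul (by norm_num),
        ← Real.rpow_natCast, ← Real.rpow_mul (by norm_num)]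
      congr 1
      push_cast
      field_simp
      norm_num
    rw [h8, show (-1 / 4 : ℝ) * (4 : ℕ) = -1 by norm_num, Real.rpow_neg_one]
    have h9 : (8 - (2 : ℝ) ^ (2 / p)) ≠ 0 := by linarith
    have h10 : 4 * (2 / (2 : ℝ) ^ (2 / p)) - 1 = (8 - 2 ^ (2 / p)) / 2 ^ (2 / p) := by
      field_simp
      norm_num
    rw [h10]
    field_simp
    norm_num

lemma hasBestEllipsoidSegment_pnorm_of_lt_two (hp1 : 1 ≤ p) (hp : p < 2)
    (hNu : ∀ u, N u = (|u 0| ^ p + |u 1| ^ p) ^ (1 / p)) :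
    HasBestEllipsoidSegment N 1 1 ((2 : ℝ) ^ (1 / p - 1 / 2))
      (√2 * ((2 : ℝ) ^ (1 + 2 / p) - 1) ^ (-1 / 4 : ℝ)) := by
  have hp0 : 0 < p := by linarith
  obtain ⟨h10, h01, h11⟩ := pnorm_values hp0 hNu
  have hinv : 1 / 2 < 1 / p := one_div_lt_one_div_of_lt hp0 hp
  have hDsq : ((2 : ℝ) ^ (1 / p - 1 / 2)) ^ 2 = 2 ^ (2 / p) / 2 := by
    rw [two_rpow_sq, show 2 * (1 / p - 1 / 2) = 2 / p - 1 by ring, Real.rpow_sub (by norm_num),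
      Real.rpow_one]
  have hgt : 1 < (2 : ℝ) ^ (2 / p) := Real.one_lt_rpow (by norm_num) (by positivity)
  have hM : (2 : ℝ) ^ (1 + 2 / p) = 2 * 2 ^ (2 / p) := by
    rw [Real.rpow_add (by norm_num), Real.rpow_one]
  refine hasBestEllipsoidSegment_of_isBest (pnorm_definite hp0 hNu) (IsEllipsoidNormFor.isBest
    ⟨one_pos, one_pos, Real.one_le_rpow (by norm_num) (by linarith), fun u => ?_⟩
    fun a' c' D' h' => ?_) (mul_nonneg (by positivity) (Real.rpow_nonneg (by linarith) _)) ?_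
  · rw [ellipseNorm_self zero_le_one, Real.sqrt_one, one_mul, euclid_eq, hNu]
    exact ⟨Real.rpow_add_rpow_le (abs_nonneg _) (abs_nonneg _) hp0 hp.le,
      rpow_add_rpow_le_two_rpow_mul (abs_nonneg (u 0)) (abs_nonneg (u 1)) hp0 hp.le⟩
  · obtain ⟨h3, h5, h6, h7⟩ := h'.bounds_of_symm h10 h01 h11
    rw [two_rpow_sq, mul_one_div] at h7
    rw [hDsq]
    constructor <;> linarith
  · rw [mul_pow, hDsq, hM, ← Real.rpow_natCast (_ ^ (-1 / 4 : ℝ)), ← Real.rpow_mul (by linarith),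
      show (-1 / 4 : ℝ) * (4 : ℕ) = -1 by norm_num, Real.rpow_neg_one,
      show √(2 : ℝ) ^ 4 = (√2 ^ 2) ^ 2 by ring, Real.sq_sqrt (by norm_num), ← div_eq_mul_inv]
    congr 1
    · norm_num
    · ring

end PNorm

end Examples

/-! ### The area of a truncated Voronoi cell -/

section Voronoi

open MeasureTheory Complex

/-- The part of the disc of radius `R` about `0` whose points are at least as close to `u`. -/
def discCap (R : ℝ) (u : ℂ) : Set ℂ := {x | ‖x‖ < R ∧ ‖x - u‖ ≤ ‖x‖}

/-- The open sector of the disc of radius `R` about `0` spanned by the arc of points closer to `u`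
than to `0`. -/
def discSector (R : ℝ) (u : ℂ) : Set ℂ :=
  {x | ‖x‖ < R ∧ ‖x‖ * ‖u‖ ^ 2 < R * (2 * (x.re * u.re + x.im * u.im))}

lemma norm_sub_sq_eq (x u : ℂ) :
    ‖x - u‖ ^ 2 = ‖x‖ ^ 2 - 2 * (x.re * u.re + x.im * u.im) + ‖u‖ ^ 2 := by
  simp only [← normSq_eq_norm_sq, normSq_apply, sub_re, sub_im]
  ring

lemma norm_sub_le_norm_iff (x u : ℂ) :
    ‖x - u‖ ≤ ‖x‖ ↔ ‖u‖ ^ 2 ≤ 2 * (x.re * u.re + x.im * u.im) := by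
  rw [← pow_le_pow_iff_left₀ (norm_nonneg _) (norm_nonneg _) two_ne_zero, norm_sub_sq_eq]
  constructor <;> intro h <;> linarith

lemma measurableSet_discCap (R : ℝ) (u : ℂ) : MeasurableSet (discCap R u) := by
  simp only [discCap, ofPred_and]
  refine (measurableSet_lt ?_ ?_).inter
    (measurableSet_le ?_ ?_) <;> fun_prop

lemma measurableSet_discSector (R : ℝ) (u : ℂ) : MeasurableSet (discSector R u) := by
  simp only [discSector, ofPred_and]
  refine (measurableSet_lt ?_ ?_).inter
    (measurableSet_lt ?_ ?_) <;> fun_prop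

/-- Sectors of points at mutual distance at least `√3 R` are disjoint: otherwise three points
at mutual distance at least `√3 R` would lie in a disc of radius `R`, two of them in its
interior. -/
lemma disjoint_discSector {R : ℝ} (hR : 0 < R) {u w : ℂ} (hu : √3 * R ≤ ‖u‖)
    (hw : √3 * R ≤ ‖w‖) (huw : √3 * R ≤ ‖u - w‖) :
    Disjoint (discSector R u) (discSector R w) := by
  rw [Set.disjoint_left]
  rintro x ⟨hx, h1⟩ ⟨-, h2⟩
  have h3 : √(3 : ℝ) ^ 2 = 3 := Real.sq_sqrt (by norm_num)
  have hsq : ∀ z : ℂ, √3 * R ≤ ‖z‖ → 3 * R ^ 2 ≤ ‖z‖ ^ 2 := fun z hz => by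
    have := pow_le_pow_left₀ (by positivity) hz 2
    rwa [mul_pow, h3] at this
  have hu' := hsq u hu
  have hw' := hsq w hw
  have huw' := hsq _ huw
  have hx0 : 0 < ‖x‖ := by
    refine norm_pos_iff.2 fun h0 => ?_
    simp [h0] at h1
  -- the point of the circle in the direction of `x`
  set y : ℂ := ((R / ‖x‖ : ℝ) : ℂ) * x with hy
  have hyn : ‖y‖ = R := by
    rw [hy, norm_mul, norm_real, Real.norm_of_nonneg (by positivity), div_mul_cancel₀ _ hx0.ne']
  have hlt : ∀ z : ℂ, ‖x‖ * ‖z‖ ^ 2 < R * (2 * (x.re * z.re + x.im * z.im)) →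
      ‖y - z‖ ^ 2 < R ^ 2 := by
    intro z hz
    rw [norm_sub_sq_eq, hyn, hy, re_ofReal_mul, im_ofReal_mul]
    have h4 : ‖z‖ ^ 2 < R * (2 * (x.re * z.re + x.im * z.im)) / ‖x‖ := by
      rwa [lt_div_iff₀' hx0]
    have h5 : R * (2 * (x.re * z.re + x.im * z.im)) / ‖x‖ =
        2 * (R / ‖x‖ * x.re * z.re + R / ‖x‖ * x.im * z.im) := by
      field_simp
    linarith
  have hyu := hlt u h1
  have hyw := hlt w h2
  have hpar : ‖u‖ ^ 2 + ‖w‖ ^ 2 + ‖u - w‖ ^ 2 + ‖3 * y - u - w‖ ^ 2 =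
      3 * (‖y‖ ^ 2 + ‖y - u‖ ^ 2 + ‖y - w‖ ^ 2) := by
    simp only [← normSq_eq_norm_sq, normSq_apply, sub_re, sub_im, mul_re, mul_im, re_ofNat,
      im_ofNat]
    ring
  rw [hyn] at hpar
  nlinarith [sq_nonneg ‖3 * y - u - w‖]

lemma volume_discSector_ofReal_le {R d : ℝ} (hR : 0 < R) (hd : 0 < d) (hdR : d < R) :
    volume (discSector R (2 * d : ℝ)) ≤ ENNReal.ofReal (R ^ 2 * Real.arccos (d / R)) := by
  set θ := Real.arccos (d / R) with hθ
  have hθ0 : 0 ≤ θ := Real.arccos_nonneg _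
  have hcos : Real.cos θ = d / R :=
    Real.cos_arccos (by linarith [div_pos hd hR]) ((div_le_one hR).2 hdR.le)
  have hpt : ∀ p ∈ polarCoord.target, ENNReal.ofReal p.1 •
      (discSector R (2 * d : ℝ)).indicator (1 : ℂ → ENNReal) (Complex.polarCoord.symm p) ≤
      (Ioo 0 R ×ˢ Ioo (-θ) θ).indicator (fun p => ENNReal.ofReal p.1) p := by
    rintro ⟨ρ, φ⟩ hp
    simp only [polarCoord_target, mem_prod, mem_Ioi, mem_Ioo] at hp
    by_cases hm : Complex.polarCoord.symm (ρ, φ) ∈ discSector R (2 * d : ℝ)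
    · rw [indicator_of_mem hm, Pi.one_apply, smul_eq_mul, mul_one]
      have hmem : (ρ, φ) ∈ Ioo 0 R ×ˢ Ioo (-θ) θ := by
        have hn : ‖Complex.polarCoord.symm (ρ, φ)‖ = ρ := by
          rw [Complex.norm_polarCoord_symm, abs_of_pos hp.1]
        have hre : (Complex.polarCoord.symm (ρ, φ)).re = ρ * Real.cos φ := by
          rw [Complex.polarCoord_symm_apply]
          simp [-ofReal_cos, -ofReal_sin]
        obtain ⟨h1, h2⟩ := hm
        rw [hn] at h1 h2
        rw [hre, norm_real, Real.norm_of_nonneg (by positivity), ofReal_re, ofReal_im, mul_zero,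
          add_zero] at h2
        refine ⟨⟨hp.1, h1⟩, abs_lt.1 ?_⟩
        by_contra! hle
        have h3 : Real.cos φ ≤ d / R := by
          rw [← hcos, ← Real.cos_abs φ]
          exact Real.cos_le_cos_of_nonneg_of_le_pi hθ0 (abs_le.2 ⟨hp.2.1.le, hp.2.2.le⟩) hle
        rw [le_div_iff₀ hR] at h3
        have h4 : 0 < ρ * d := mul_pos hp.1 hd
        nlinarith
      rw [indicator_of_mem hmem]
    · rw [indicator_of_notMem hm]
      simp
  calc volume (discSector R (2 * d : ℝ))
      = ∫⁻ x, (discSector R (2 * d : ℝ)).indicator 1 x := by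
        rw [lintegral_indicator_one (measurableSet_discSector _ _)]
    _ = ∫⁻ p in polarCoord.target, ENNReal.ofReal p.1 •
        (discSector R (2 * d : ℝ)).indicator (1 : ℂ → ENNReal) (Complex.polarCoord.symm p) :=
        (Complex.lintegral_comp_polarCoord_symm _).symm
    _ ≤ ∫⁻ p in polarCoord.target,
        (Ioo 0 R ×ˢ Ioo (-θ) θ).indicator (fun p => ENNReal.ofReal p.1) p :=
        setLIntegral_mono' polarCoord.open_target.measurableSet hpt
    _ ≤ ∫⁻ p, (Ioo 0 R ×ˢ Ioo (-θ) θ).indicator (fun p : ℝ × ℝ => ENNReal.ofReal p.1) p :=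
        setLIntegral_le_lintegral _ _
    _ = ∫⁻ p in Ioo 0 R ×ˢ Ioo (-θ) θ, ENNReal.ofReal (p : ℝ × ℝ).1 * 1 := by
        rw [lintegral_indicator (measurableSet_Ioo.prod measurableSet_Ioo)]
        simp
    _ = (∫⁻ ρ in Ioo 0 R, ENNReal.ofReal ρ) * ∫⁻ _ in Ioo (-θ) θ, 1 := by
        rw [Measure.volume_eq_prod, ← Measure.prod_restrict]
        exact lintegral_prod_mul (f := ENNReal.ofReal) (g := fun _ => 1)
          ENNReal.measurable_ofReal.aemeasurable aemeasurable_const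
    _ = ENNReal.ofReal (R ^ 2 / 2) * ENNReal.ofReal (2 * θ) := by
        congr 1
        · rw [← ofReal_integral_eq_lintegral_ofReal]
          · rw [← integral_Ioc_eq_integral_Ioo, ← intervalIntegral.integral_of_le hR.le,
              integral_id]
            simp
          · exact (continuous_id.integrableOn_Icc).mono_set Ioo_subset_Icc_self
          · exact (ae_restrict_mem measurableSet_Ioo).mono fun x hx => hx.1.le
        · rw [setLIntegral_one, Real.volume_Ioo]
          congr 1
          ring
    _ = ENNReal.ofReal (R ^ 2 * θ) := by
        rw [← ENNReal.ofReal_mul (by positivity)]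
        congr 1
        ring

/-- The open isosceles triangle with apex `0`, height `d` along the real axis and base `2 d t`. -/
def apexTriangle (d t : ℝ) : Set ℂ := {x | 0 < x.re ∧ x.re < d ∧ -(x.re * t) < x.im ∧
  x.im < x.re * t}

lemma measurableSet_apexTriangle (d t : ℝ) : MeasurableSet (apexTriangle d t) := by
  simp only [apexTriangle, ofPred_and]
  refine (measurableSet_lt ?_ ?_).inter
    ((measurableSet_lt ?_ ?_).inter
    ((measurableSet_lt ?_ ?_).inter
    (measurableSet_lt ?_ ?_))) <;> fun_prop

lemma volume_apexTriangle {d t : ℝ} (hd : 0 < d) (ht : 0 ≤ t) :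
    volume (apexTriangle d t) = ENNReal.ofReal (d ^ 2 * t) := by
  have h1 : apexTriangle d t = Complex.measurableEquivRealProd ⁻¹'
      regionBetween (fun x => -(x * t)) (fun x => x * t) (Ioo 0 d) := by
    ext x
    simp [apexTriangle, regionBetween, and_assoc]
  rw [h1, Complex.volume_preserving_equiv_real_prod.measure_preimage
    (measurableSet_regionBetween (by fun_prop) (by fun_prop) measurableSet_Ioo).nullMeasurableSet,
    Measure.volume_eq_prod, volume_regionBetween_eq_integral]
  · congr 1
    rw [← integral_Ioc_eq_integral_Ioo, ← intervalIntegral.integral_of_le hd.le]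
    have : ∀ x : ℝ, ((fun x => x * t) - fun x => -(x * t)) x = (2 * t) * x := fun x => by
      simp only [Pi.sub_apply]
      ring
    simp only [this]
    rw [intervalIntegral.integral_const_mul, integral_id]
    ring
  · exact (Continuous.integrableOn_Icc (by fun_prop)).mono_set Ioo_subset_Icc_self
  · exact (Continuous.integrableOn_Icc (by fun_prop)).mono_set Ioo_subset_Icc_self
  · exact measurableSet_Ioo
  · intro x hx
    have := mul_nonneg hx.1.le ht
    linarith

/-- Concavity of the sine on `[0, π]`. -/
lemma mul_le_sin_mul_cos {θ : ℝ} (h0 : 0 ≤ θ) (h1 : θ ≤ Real.pi / 6) :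
    3 * √3 / (2 * Real.pi) * θ ≤ Real.sin θ * Real.cos θ := by
  have hpi := Real.pi_pos
  have h2 := strictConcaveOn_sin_Icc.concaveOn.2
    (show (0 : ℝ) ∈ Icc 0 Real.pi from ⟨le_rfl, hpi.le⟩)
    (show Real.pi / 3 ∈ Icc 0 Real.pi from ⟨by positivity, by linarith⟩)
    (show 0 ≤ 1 - 6 * θ / Real.pi by rw [sub_nonneg, div_le_one hpi]; linarith)
    (show 0 ≤ 6 * θ / Real.pi by positivity) (by ring)
  rw [smul_zero, zero_add, Real.sin_zero, smul_zero, zero_add, smul_eq_mul, smul_eq_mul,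
    Real.sin_pi_div_three, show 6 * θ / Real.pi * (Real.pi / 3) = 2 * θ by field_simp; ring,
    Real.sin_two_mul] at h2
  have h3 : 3 * √3 / (2 * Real.pi) * θ = 6 * θ / Real.pi * (√3 / 2) / 2 := by
    field_simp
    ring
  rw [h3]
  linarith

/-- A cap takes at most the fraction `1 - 3√3 / (2π)` of its sector, the worst case being the
angle `π / 3` of the regular hexagon. -/
lemma volume_discCap_ofReal_le {R d : ℝ} (hR : 0 < R) (hd : √3 * R ≤ 2 * d) :
    volume (discCap R (2 * d : ℝ)) ≤
      ENNReal.ofReal (1 - 3 * √3 / (2 * Real.pi)) * volume (discSector R (2 * d : ℝ)) := by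
  have hd0 : 0 < d := by
    have : 0 < √3 * R := by positivity
    linarith
  have hcap : ∀ x ∈ discCap R (2 * d : ℝ), ‖x‖ < R ∧ d ≤ x.re := by
    rintro x ⟨h1, h2⟩
    rw [norm_sub_le_norm_iff, norm_real, Real.norm_of_nonneg (by positivity), ofReal_re,
      ofReal_im] at h2
    refine ⟨h1, ?_⟩
    nlinarith
  rcases le_or_gt R d with hRd | hdR
  · have : discCap R (2 * d : ℝ) = ∅ := by
      refine eq_empty_of_forall_notMem fun x hx => ?_
      obtain ⟨h1, h2⟩ := hcap x hx
      linarith [re_le_norm x]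
    rw [this, measure_empty]
    exact zero_le
  set θ := Real.arccos (d / R) with hθ
  have hθ0 : 0 < θ := Real.arccos_pos.2 ((div_lt_one hR).2 hdR)
  have hcos : Real.cos θ = d / R :=
    Real.cos_arccos (by linarith [div_pos hd0 hR]) ((div_le_one hR).2 hdR.le)
  have hpi := Real.pi_pos
  have hθ6 : θ ≤ Real.pi / 6 := by
    have h1 : Real.cos (Real.pi / 6) ≤ d / R := by
      rw [Real.cos_pi_div_six, le_div_iff₀ hR]
      linarith
    have h2 := Real.arccos_le_arccos h1
    rwa [Real.arccos_cos (by positivity) (by linarith)] at h2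
  have hcos0 : 0 < Real.cos θ := by rw [hcos]; positivity
  have hsin0 : 0 ≤ Real.sin θ := Real.sin_nonneg_of_nonneg_of_le_pi hθ0.le (by linarith)
  have hdc : d = R * Real.cos θ := by
    rw [hcos]
    field_simp
  have hT := volume_apexTriangle hd0 (t := Real.tan θ)
    (by rw [Real.tan_eq_sin_div_cos]; positivity)
  have hS := volume_discSector_ofReal_le hR hd0 hdR
  rw [← hθ] at hS
  have hTval : d ^ 2 * Real.tan θ = R ^ 2 * (Real.sin θ * Real.cos θ) := by
    rw [hdc, Real.tan_eq_sin_div_cos]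
    field_simp
  rw [hTval] at hT
  have hsub : discCap R (2 * d : ℝ) ∪ apexTriangle d (Real.tan θ) ⊆ discSector R (2 * d : ℝ) := by
    have hn : ‖((2 * d : ℝ) : ℂ)‖ = 2 * d := by
      rw [norm_real, Real.norm_of_nonneg (by positivity)]
    rintro x (hx | ⟨h1, h2, h3, h4⟩)
    · obtain ⟨h1, h2⟩ := hcap x hx
      refine ⟨h1, ?_⟩
      rw [hn, ofReal_re, ofReal_im, mul_zero, add_zero]
      have h5 : ‖x‖ * d < R * x.re := by
        calc ‖x‖ * d < R * d := mul_lt_mul_of_pos_right h1 hd0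
          _ ≤ R * x.re := mul_le_mul_of_nonneg_left h2 hR.le
      nlinarith
    · -- in the triangle `‖x‖ cos θ < re x`
      have h5 : ‖x‖ * Real.cos θ < x.re := by
        refine lt_of_pow_lt_pow_left₀ 2 h1.le ?_
        have h6 : x.im ^ 2 < (x.re * Real.tan θ) ^ 2 := sq_lt_sq' h3 h4
        rw [Real.tan_eq_sin_div_cos, mul_div_assoc', div_pow, lt_div_iff₀ (by positivity)] at h6
        rw [mul_pow, ← normSq_eq_norm_sq, normSq_apply]
        nlinarith [Real.sin_sq_add_cos_sq θ]
      have h6 : ‖x‖ * d < R * x.re := by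
        rw [hdc]
        nlinarith
      refine ⟨?_, ?_⟩
      · nlinarith [norm_nonneg x]
      · rw [hn, ofReal_re, ofReal_im, mul_zero, add_zero]
        nlinarith
  have hdisj : Disjoint (discCap R (2 * d : ℝ)) (apexTriangle d (Real.tan θ)) := by
    rw [Set.disjoint_left]
    rintro x hx ⟨-, h2, -⟩
    linarith [(hcap x hx).2]
  have hsum := measure_mono (μ := volume) hsub
  rw [measure_union hdisj (measurableSet_apexTriangle _ _), hT] at hsum
  have hfin : volume (discSector R (2 * d : ℝ)) ≠ ⊤ := ne_top_of_le_ne_top ENNReal.ofReal_ne_top hS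
  have hSr := ENNReal.toReal_le_of_le_ofReal (by positivity) hS
  have hcfin : volume (discCap R (2 * d : ℝ)) ≠ ⊤ :=
    ne_top_of_le_ne_top hfin (le_trans le_self_add hsum)
  have hsr := ENNReal.toReal_mono hfin hsum
  rw [ENNReal.toReal_add hcfin ENNReal.ofReal_ne_top,
    ENNReal.toReal_ofReal (by positivity)] at hsr
  have hkey := mul_le_sin_mul_cos hθ0.le hθ6
  rw [← ENNReal.ofReal_toReal hcfin]
  conv_rhs => rw [← ENNReal.ofReal_toReal hfin]
  set S := (volume (discSector R (2 * d : ℝ))).toReal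
  have hS0 : 0 ≤ S := ENNReal.toReal_nonneg
  rw [← ENNReal.ofReal_mul' hS0]
  refine ENNReal.ofReal_le_ofReal ?_
  have h7 : 3 * √3 / (2 * Real.pi) * S ≤ 3 * √3 / (2 * Real.pi) * (R ^ 2 * θ) :=
    mul_le_mul_of_nonneg_left hSr (by positivity)
  have h8 : R ^ 2 * (3 * √3 / (2 * Real.pi) * θ) ≤ R ^ 2 * (Real.sin θ * Real.cos θ) :=
    mul_le_mul_of_nonneg_left hkey (by positivity)
  nlinarith

lemma volume_discCap_le {R : ℝ} (hR : 0 < R) {u : ℂ} (hu : √3 * R ≤ ‖u‖) :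
    volume (discCap R u) ≤
      ENNReal.ofReal (1 - 3 * √3 / (2 * Real.pi)) * volume (discSector R u) := by
  have hu0 : 0 < ‖u‖ := lt_of_lt_of_le (by positivity) hu
  -- rotate `u` to the positive real axis
  obtain ⟨ζ, hζ⟩ : ∃ ζ : Circle, (ζ : ℂ) * (‖u‖ : ℝ) = u := by
    refine ⟨⟨u / ‖u‖, ?_⟩, ?_⟩
    · simp [Submonoid.unitSphere, hu0.ne']
    · exact div_mul_cancel₀ u (ofReal_ne_zero.2 hu0.ne')
  have hrot : MeasurePreserving (rotation ζ) volume volume :=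
    (rotation ζ).measurePreserving
  have hnu : ((2 * (‖u‖ / 2) : ℝ) : ℂ) = (‖u‖ : ℝ) := by
    congr 1
    ring
  have h1 : rotation ζ ⁻¹' discCap R u = discCap R (2 * (‖u‖ / 2) : ℝ) := by
    ext x
    rw [hnu]
    simp only [discCap, mem_preimage, mem_ofPred_eq, LinearIsometryEquiv.norm_map]
    have : ‖rotation ζ x - u‖ = ‖x - (‖u‖ : ℝ)‖ := by
      rw [rotation_apply]
      conv_lhs => rw [← hζ]
      rw [← mul_sub, norm_mul, Circle.norm_coe, one_mul]
    rw [this]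
  have h2 : rotation ζ ⁻¹' discSector R u = discSector R (2 * (‖u‖ / 2) : ℝ) := by
    ext x
    rw [hnu]
    have h3 := norm_sub_sq_eq (rotation ζ x) u
    have h4 := norm_sub_sq_eq x (‖u‖ : ℝ)
    have : ‖rotation ζ x - u‖ = ‖x - (‖u‖ : ℝ)‖ := by
      rw [rotation_apply]
      conv_lhs => rw [← hζ]
      rw [← mul_sub, norm_mul, Circle.norm_coe, one_mul]
    have h5 : ‖((‖u‖ : ℝ) : ℂ)‖ = ‖u‖ := by simp
    rw [this, LinearIsometryEquiv.norm_map] at h3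
    rw [h5] at h4
    simp only [discSector, mem_preimage, mem_ofPred_eq, LinearIsometryEquiv.norm_map, h5]
    rw [show 2 * ((rotation ζ x).re * u.re + (rotation ζ x).im * u.im) =
      2 * (x.re * ((‖u‖ : ℝ) : ℂ).re + x.im * ((‖u‖ : ℝ) : ℂ).im) by linarith]
  rw [← hrot.measure_preimage (measurableSet_discCap R u).nullMeasurableSet, h1,
    ← hrot.measure_preimage (measurableSet_discSector R u).nullMeasurableSet, h2]
  exact volume_discCap_ofReal_le hR (by linarith)

/-- The Voronoi cell of `0` among points at mutual distance at least `√3 R`, even if cut off at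
distance `R`, has at least the area `3√3 R² / 2` of a regular hexagon of circumradius `R`. -/
theorem le_volume_voronoi {R : ℝ} (hR : 0 < R) {U : Set ℂ} (hU : U.Countable)
    (h0 : ∀ u ∈ U, √3 * R ≤ ‖u‖) (hsep : ∀ u ∈ U, ∀ w ∈ U, u ≠ w → √3 * R ≤ ‖u - w‖) :
    ENNReal.ofReal (3 * √3 / 2 * R ^ 2) ≤
      volume {x : ℂ | ‖x‖ < R ∧ ∀ u ∈ U, ‖x‖ < ‖x - u‖} := by
  have hpi := Real.pi_pos
  set κ := 1 - 3 * √3 / (2 * Real.pi) with hκ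
  have hκ0 : 0 ≤ κ := by
    rw [hκ, sub_nonneg, div_le_one (by positivity)]
    have : √(3 : ℝ) ≤ 2 := Real.sqrt_le_iff.2 ⟨by norm_num, by norm_num⟩
    linarith [Real.pi_gt_three]
  have hball : volume (Metric.ball (0 : ℂ) R) = ENNReal.ofReal (Real.pi * R ^ 2) := by
    rw [Complex.volume_ball, mul_comm, ENNReal.ofReal_mul hpi.le, ENNReal.ofReal_pow hR.le]
    congr 1
    simp [ENNReal.ofReal, Real.toNNReal_of_nonneg hpi.le]
    rfl
  have hcaps : volume (⋃ u ∈ U, discCap R u) ≤ ENNReal.ofReal (κ * (Real.pi * R ^ 2)) := by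
    have := hU.to_subtype
    calc volume (⋃ u ∈ U, discCap R u) = volume (⋃ u : U, discCap R u.1) := by
          rw [iUnion_coe_set]
      _ ≤ ∑' u : U, volume (discCap R u.1) := measure_iUnion_le _
      _ ≤ ∑' u : U, ENNReal.ofReal κ * volume (discSector R u.1) :=
          ENNReal.tsum_le_tsum fun u => volume_discCap_le hR (h0 u.1 u.2)
      _ = ENNReal.ofReal κ * ∑' u : U, volume (discSector R u.1) := ENNReal.tsum_mul_left
      _ = ENNReal.ofReal κ * volume (⋃ u : U, discSector R u.1) := by
          rw [measure_iUnion]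
          · intro u w huw
            exact disjoint_discSector hR (h0 _ u.2) (h0 _ w.2)
              (hsep _ u.2 _ w.2 fun h => huw (Subtype.ext h))
          · exact fun u => measurableSet_discSector _ _
      _ ≤ ENNReal.ofReal κ * volume (Metric.ball (0 : ℂ) R) := by
          gcongr
          refine iUnion_subset fun u x hx => ?_
          simpa using hx.1
      _ = _ := by rw [hball, ENNReal.ofReal_mul hκ0]
  have hset : Metric.ball (0 : ℂ) R \ ⋃ u ∈ U, discCap R u ⊆
      {x : ℂ | ‖x‖ < R ∧ ∀ u ∈ U, ‖x‖ < ‖x - u‖} := by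
    rintro x ⟨h1, h2⟩
    have h3 : ‖x‖ < R := by simpa using h1
    refine ⟨h3, fun u hu => ?_⟩
    by_contra! hle
    exact h2 (mem_biUnion hu ⟨h3, hle⟩)
  refine le_trans ?_ (measure_mono hset)
  refine le_trans ?_ (le_measure_sdiff)
  rw [hball]
  refine le_trans ?_ (tsub_le_tsub_left hcaps _)
  rw [← ENNReal.ofReal_sub _ (by positivity)]
  refine ENNReal.ofReal_le_ofReal (le_of_eq ?_)
  rw [hκ]
  field_simp
  ring

end Voronoi

/-! ### The upper bound for ellipse norms -/

section UpperBound

open MeasureTheory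

variable {N : Seminorm ℝ (Fin 2 → ℝ)}

lemma volume_preimage_ellipse {a c : ℝ} (ha : 0 < a) (hc : 0 < c) {A : Set ℂ}
    (hA : MeasurableSet A) :
    volume ((fun u : Fin 2 → ℝ => (⟨√a * u 0, √c * u 1⟩ : ℂ)) ⁻¹' A) =
      ENNReal.ofReal (√(a * c))⁻¹ * volume A := by
  set f : (Fin 2 → ℝ) →ₗ[ℝ] (Fin 2 → ℝ) := Matrix.toLin' (Matrix.diagonal ![√a, √c]) with hf
  have hdet : LinearMap.det f = √(a * c) := by
    rw [hf, LinearMap.det_toLin', Matrix.det_diagonal, Fin.prod_univ_two, Real.sqrt_mul ha.le]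
    simp
  have hpos : 0 < √(a * c) := Real.sqrt_pos.2 (mul_pos ha hc)
  have h1 : (fun u : Fin 2 → ℝ => (⟨√a * u 0, √c * u 1⟩ : ℂ)) ⁻¹' A =
      f ⁻¹' (Complex.measurableEquivPi.symm ⁻¹' A) := by
    ext u
    simp only [mem_preimage, hf, Matrix.toLin'_apply, Complex.measurableEquivPi_symm_apply,
      Matrix.mulVec_diagonal]
    have : (⟨√a * u 0, √c * u 1⟩ : ℂ) = ((√a * u 0 : ℝ) : ℂ) + ((√c * u 1 : ℝ) : ℂ) * Complex.I :=
      Complex.mk_eq_add_mul_I _ _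
    rw [this]
    simp
  rw [h1, Measure.addHaar_preimage_linearMap _ (by rw [hdet]; exact hpos.ne'), hdet,
    abs_of_pos (inv_pos.2 hpos),
    Complex.volume_preserving_equiv_pi.symm.measure_preimage hA.nullMeasurableSet]

/-- The point `i v + z`, for `0 ≤ i < m` and `z ∈ ℤ²`. -/
def orbitPoint (v : Fin 2 → ℝ) {m : ℕ} (x : Fin m × (Fin 2 → ℤ)) : Fin 2 → ℝ :=
  (x.1 : ℝ) • v + intVec x.2

/-- The Voronoi cell of a point of the configuration `{i v + z}`, cut off at distance `R`. -/
def orbitCell (N : Seminorm ℝ (Fin 2 → ℝ)) (v : Fin 2 → ℝ) {m : ℕ} (R : ℝ)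
    (x : Fin m × (Fin 2 → ℤ)) : Set (Fin 2 → ℝ) :=
  {y | N (y - orbitPoint v x) < R ∧
    ∀ x', x' ≠ x → N (y - orbitPoint v x) < N (y - orbitPoint v x')}

lemma orbitCell_disjoint (v : Fin 2 → ℝ) {m : ℕ} (R : ℝ) {x x' : Fin m × (Fin 2 → ℤ)}
    (h : x ≠ x') : Disjoint (orbitCell N v R x) (orbitCell N v R x') := by
  rw [Set.disjoint_left]
  rintro y ⟨-, h1⟩ ⟨-, h2⟩
  exact lt_asymm (h1 x' h.symm) (h2 x h)

lemma measurableSet_orbitCell (v : Fin 2 → ℝ) {m : ℕ} (R : ℝ) (x : Fin m × (Fin 2 → ℤ)) :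
    MeasurableSet (orbitCell N v R x) := by
  have h1 : ∀ x' : Fin m × (Fin 2 → ℤ), Measurable fun y => N (y - orbitPoint v x') :=
    fun x' => ((seminorm_continuous N).comp (continuous_id.sub continuous_const)).measurable
  simp only [orbitCell, ofPred_and, ofPred_forall]
  exact (measurableSet_lt (h1 x) measurable_const).inter
    (MeasurableSet.iInter fun x' => MeasurableSet.iInter fun _ => measurableSet_lt (h1 x) (h1 x'))

lemma intVec_sub {d : ℕ} (z z' : Fin d → ℤ) : intVec (z - z') = intVec z - intVec z' := by
  ext i
  simp [intVec]

lemma intVec_add_mem_orbitCell {v : Fin 2 → ℝ} {m : ℕ} {R : ℝ} {i : Fin m} {y : Fin 2 → ℝ}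
    (z : Fin 2 → ℤ) (hy : y ∈ orbitCell N v R (i, 0)) :
    intVec z + y ∈ orbitCell N v R (i, z) := by
  have h0 : ∀ (j : Fin m) (z' : Fin 2 → ℤ),
      intVec z + y - orbitPoint v (j, z') = y - orbitPoint v (j, z' - z) := by
    intro j z'
    simp only [orbitPoint, intVec_sub]
    abel
  obtain ⟨h1, h2⟩ := hy
  refine ⟨?_, ?_⟩
  · rw [h0, sub_self]
    exact h1
  · rintro ⟨j, z'⟩ hne
    rw [h0, h0, sub_self]
    refine h2 _ fun h => hne ?_
    rw [Prod.mk.injEq] at h ⊢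
    exact ⟨h.1, sub_eq_zero.1 h.2⟩

lemma le_seminorm_orbitPoint_sub {v : Fin 2 → ℝ} {m : ℕ} {r : ℝ}
    (h1 : ∀ k : ℕ, 1 ≤ k → k < m → r ≤ latticeDist N ((k : ℝ) • v))
    (h2 : ∀ z : Fin 2 → ℤ, z ≠ 0 → r ≤ N (intVec z)) {x x' : Fin m × (Fin 2 → ℤ)}
    (h : x ≠ x') : r ≤ N (orbitPoint v x - orbitPoint v x') := by
  wlog hle : x'.1 ≤ x.1 generalizing x x'
  · rw [map_sub_rev]
    exact this h.symm (le_of_not_ge hle)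
  obtain ⟨i, z⟩ := x
  obtain ⟨i', z'⟩ := x'
  simp only at hle
  rcases eq_or_lt_of_le hle with rfl | hlt
  · have h3 : orbitPoint v (i', z) - orbitPoint v (i', z') = intVec (z - z') := by
      simp only [orbitPoint, intVec_sub]
      abel
    rw [h3]
    refine h2 _ fun h4 => h ?_
    rw [sub_eq_zero.1 h4]
  · have hlt' : (i' : ℕ) < i := hlt
    have h3 : orbitPoint v (i, z) - orbitPoint v (i', z') =
        ((i - i' : ℕ) : ℝ) • v - intVec (z' - z) := by
      simp only [orbitPoint, intVec_sub]
      rw [Nat.cast_sub hlt'.le, sub_smul]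
      abel
    rw [h3]
    exact (h1 _ (by omega) (by have := i.2; omega)).trans (latticeDist_le N _ _)

lemma le_volume_orbitCell {a c : ℝ} (ha : 0 < a) (hc : 0 < c)
    (hNu : ∀ u, N u = √(a * u 0 ^ 2 + c * u 1 ^ 2)) {v : Fin 2 → ℝ} {m : ℕ} {r : ℝ} (hr : 0 < r)
    (hsep : ∀ x x' : Fin m × (Fin 2 → ℤ), x ≠ x' → r ≤ N (orbitPoint v x - orbitPoint v x'))
    (x : Fin m × (Fin 2 → ℤ)) :
    ENNReal.ofReal ((√(a * c))⁻¹ * (√3 / 2 * r ^ 2)) ≤ volume (orbitCell N v (r / √3) x) := by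
  set φ : (Fin 2 → ℝ) → ℂ := fun u => ⟨√a * u 0, √c * u 1⟩ with hφ
  have hφN : ∀ u, ‖φ u‖ = N u := by
    intro u
    rw [hNu, Complex.norm_def, Complex.normSq_apply]
    congr 1
    simp only [hφ]
    nlinarith [Real.mul_self_sqrt ha.le, Real.mul_self_sqrt hc.le]
  have hφsub : ∀ u w, φ (u - w) = φ u - φ w := by
    intro u w
    apply Complex.ext <;> simp [hφ] <;> ring
  have h3 : (0 : ℝ) < √3 := by positivity
  have hR : √3 * (r / √3) = r := by field_simp
  set U : Set ℂ := (fun x' => φ (orbitPoint v x' - orbitPoint v x)) '' {x' | x' ≠ x} with hU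
  set V : Set ℂ := {w | ‖w‖ < r / √3 ∧ ∀ u ∈ U, ‖w‖ < ‖w - u‖} with hV
  have hUc : U.Countable := (Set.to_countable _).image _
  have hVol : ENNReal.ofReal (√3 / 2 * r ^ 2) ≤ volume V := by
    have h := le_volume_voronoi (R := r / √3) (by positivity) hUc (by
      rintro _ ⟨x', hx', rfl⟩
      rw [hR, hφN]
      exact hsep _ _ hx') (by
      rintro _ ⟨x', hx', rfl⟩ _ ⟨x'', hx'', rfl⟩ hne
      rw [hR, ← hφsub, hφN, sub_sub_sub_cancel_right]
      exact hsep _ _ fun h => hne (by rw [h]))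
    convert h using 2
    rw [div_pow, Real.sq_sqrt (by norm_num)]
    ring
  have hVm : MeasurableSet V := by
    simp only [hV, ofPred_and, ofPred_forall]
    exact (measurableSet_lt (by fun_prop) (by fun_prop)).inter
      (MeasurableSet.biInter hUc fun u _ => measurableSet_lt (by fun_prop) (by fun_prop))
  have hcell : orbitCell N v (r / √3) x = (fun y => y + -orbitPoint v x) ⁻¹' (φ ⁻¹' V) := by
    ext y
    simp only [orbitCell, hV, hU, mem_preimage, mem_ofPred_eq, forall_mem_image, ← hφsub, hφN,
      ← sub_eq_add_neg, sub_sub_sub_cancel_right]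
  rw [hcell, measure_preimage_add_right, volume_preimage_ellipse ha hc hVm,
    ENNReal.ofReal_mul (by positivity)]
  gcongr

/-- Thue's theorem on the torus: if the points `i v + z` with `0 ≤ i < m`, `z ∈ ℤ²` have mutual
distances at least `r`, then their density `m` is at most that of a hexagonal lattice. -/
theorem card_mul_sq_le {a c : ℝ} (ha : 0 < a) (hc : 0 < c)
    (hNu : ∀ u, N u = √(a * u 0 ^ 2 + c * u 1 ^ 2)) {v : Fin 2 → ℝ} {m : ℕ} {r : ℝ} (hr : 0 < r)
    (h1 : ∀ k : ℕ, 1 ≤ k → k < m → r ≤ latticeDist N ((k : ℝ) • v))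
    (h2 : ∀ z : Fin 2 → ℤ, z ≠ 0 → r ≤ N (intVec z)) :
    m * (√3 / 2 * r ^ 2) ≤ √(a * c) := by
  by_contra! hlt
  have hpos : 0 < √(a * c) := Real.sqrt_pos.2 (mul_pos ha hc)
  set s : Set (Fin 2 → ℝ) := ⋃ i : Fin m, orbitCell N v (r / √3) (i, 0) with hs
  have hvol : volume (ZSpan.fundamentalDomain (Pi.basisFun ℝ (Fin 2))) < volume s := by
    have e1 : volume (ZSpan.fundamentalDomain (Pi.basisFun ℝ (Fin 2))) = 1 := by
      rw [ZSpan.fundamentalDomain_pi_basisFun, Real.volume_pi_Ico]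
      simp
    have e2 : volume s = ∑ i : Fin m, volume (orbitCell N v (r / √3) (i, 0)) := by
      rw [hs, measure_iUnion, tsum_fintype]
      · exact fun i j hij => orbitCell_disjoint v _ fun h => hij (Prod.mk.inj h).1
      · exact fun i => measurableSet_orbitCell v _ _
    rw [e1, e2]
    calc (1 : ENNReal) < ENNReal.ofReal (m * ((√(a * c))⁻¹ * (√3 / 2 * r ^ 2))) := by
          rw [← ENNReal.ofReal_one]
          refine (ENNReal.ofReal_lt_ofReal_iff_of_nonneg zero_le_one).2 ?_
          rw [← mul_assoc, mul_comm (m : ℝ), mul_assoc, inv_mul_eq_div, lt_div_iff₀ hpos, one_mul]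
          exact hlt
      _ = ∑ i : Fin m, ENNReal.ofReal ((√(a * c))⁻¹ * (√3 / 2 * r ^ 2)) := by
          rw [Finset.sum_const, Finset.card_univ, Fintype.card_fin, nsmul_eq_mul,
            ENNReal.ofReal_mul (by positivity), ENNReal.ofReal_natCast]
      _ ≤ _ := Finset.sum_le_sum fun i _ => le_volume_orbitCell ha hc hNu hr
            (fun x x' hx => le_seminorm_orbitPoint_sub h1 h2 hx) (i, 0)
  have hsm : MeasurableSet s := MeasurableSet.iUnion fun i => measurableSet_orbitCell v _ _
  have hint : ∀ w : (Submodule.span ℤ (range (Pi.basisFun ℝ (Fin 2)))).toAddSubgroup,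
      ∃ z : Fin 2 → ℤ, (w : Fin 2 → ℝ) = intVec z := by
    intro w
    have h := (Module.Basis.mem_span_iff_repr_mem ℤ (Pi.basisFun ℝ (Fin 2)) w.1).1 w.2
    choose z hz using h
    refine ⟨z, ?_⟩
    ext i
    have := hz i
    simp only [Pi.basisFun_repr] at this
    rw [← this]
    simp [intVec]
  choose z hz using hint
  have hcount : Countable (Submodule.span ℤ (range (Pi.basisFun ℝ (Fin 2)))).toAddSubgroup :=
    Function.Injective.countable (f := z) fun x y h => by
      apply Subtype.ext
      rw [hz, hz, h]
  -- Blichfeldt's theorem gives two overlapping translates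
  obtain ⟨x, y, hxy, hdisj⟩ := exists_pair_mem_lattice_not_disjoint_vadd
    (ZSpan.isAddFundamentalDomain' (Pi.basisFun ℝ (Fin 2)) volume) hsm.nullMeasurableSet hvol
  rw [Set.not_disjoint_iff] at hdisj
  obtain ⟨p, ⟨p₁, hp₁, e1⟩, ⟨p₂, hp₂, e2⟩⟩ := hdisj
  obtain ⟨i, hi⟩ := mem_iUnion.1 hp₁
  obtain ⟨j, hj⟩ := mem_iUnion.1 hp₂
  have e1' : intVec (z x) + p₁ = p := by rw [← hz]; exact e1
  have e2' : intVec (z y) + p₂ = p := by rw [← hz]; exact e2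
  have m1 := intVec_add_mem_orbitCell (z x) hi
  have m2 := intVec_add_mem_orbitCell (z y) hj
  rw [e1'] at m1
  rw [e2'] at m2
  refine Set.disjoint_left.1 (orbitCell_disjoint v _ fun h => hxy ?_) m1 m2
  apply Subtype.ext
  rw [hz, hz, (Prod.mk.inj h).2]

lemma one_le_norm_intVec {z : Fin 2 → ℤ} (hz : z ≠ 0) : 1 ≤ ‖intVec z‖ := by
  obtain ⟨i, hi⟩ := Function.ne_iff.1 hz
  refine le_trans ?_ (norm_le_pi_norm (intVec z) i)
  rw [intVec, Real.norm_eq_abs]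
  exact_mod_cast Int.one_le_abs hi

/-- For an ellipse norm Dirichlet's theorem holds with the constant `ellipsoidValue a c 1`: if
`⟨k v⟩ > r` for all `1 ≤ k ≤ T`, the `⌊T⌋ + 1 > T` points `0, v, …, ⌊T⌋ v` of the torus are
separated by `r`. -/
theorem ellipsoidValue_mem_dirichletConstants {a c : ℝ} (ha : 0 < a) (hc : 0 < c)
    (hNu : ∀ u, N u = √(a * u 0 ^ 2 + c * u 1 ^ 2)) (hN : ∀ x, N x = 0 → x = 0) :
    ellipsoidValue a c 1 ∈ dirichletConstants N := by
  have hγ := ellipsoidValue_pos ha hc le_rfl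
  have hγ4 := ellipsoidValue_pow_four ha.le hc.le le_rfl
  set γ := ellipsoidValue a c 1 with hγdef
  obtain ⟨κ, hκ, hlow⟩ := exists_mul_norm_le_seminorm hN
  refine ⟨hγ, max 1 ((γ / κ) ^ 2), fun T hT v _ => ?_⟩
  by_contra! hcon
  have hT1 : 1 ≤ T := (le_max_left _ _).trans hT
  have hT0 : 0 < T := by linarith
  have hsT : 0 < √T := Real.sqrt_pos.2 hT0
  have h := card_mul_sq_le ha hc hNu (v := v) (m := ⌊T⌋₊ + 1) (r := γ / √T) (by positivity)
    (fun k hk hkm => by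
      have := hcon k hk ((Nat.le_floor_iff hT0.le).1 (Nat.lt_succ_iff.1 hkm))
      rw [Nat.cast_ofNat, ← Real.sqrt_eq_rpow] at this
      rw [div_le_iff₀' hsT]
      exact this.le)
    (fun z hz => by
      refine le_trans ?_ (hlow _)
      have h1 : γ / κ ≤ √T := Real.le_sqrt_of_sq_le ((le_max_right _ _).trans hT)
      rw [div_le_iff₀ hκ] at h1
      rw [div_le_iff₀ hsT]
      nlinarith [mul_le_mul_of_nonneg_left (one_le_norm_intVec hz) hκ.le])
  rw [div_pow, Real.sq_sqrt hT0.le] at h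
  have hval : √3 / 2 * γ ^ 2 = √(a * c) := by
    refine (pow_left_inj₀ (by positivity) (Real.sqrt_nonneg _) two_ne_zero).1 ?_
    rw [Real.sq_sqrt (by positivity), mul_pow, div_pow, Real.sq_sqrt (by norm_num), ← pow_mul,
      hγ4]
    norm_num
    ring
  have hpos : 0 < √(a * c) := Real.sqrt_pos.2 (mul_pos ha hc)
  have hlt := Nat.lt_floor_add_one T
  have h5 : ((⌊T⌋₊ + 1 : ℕ) : ℝ) * (√3 / 2 * (γ ^ 2 / T)) =
      ((⌊T⌋₊ + 1 : ℕ) : ℝ) * √(a * c) / T := by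
    rw [← hval]
    ring
  rw [h5, div_le_iff₀ hT0] at h
  push_cast at h
  nlinarith

/-! ### The spectrum of an ellipse norm -/

/-- The Dirichlet spectrum lies below every Dirichlet constant. -/
lemma dirichletSpectrum_subset_Icc {C : ℝ} (hC : C ∈ dirichletConstants N) :
    dirichletSpectrum N ⊆ Icc 0 C := by
  rintro s ⟨v, hv, hlim⟩
  obtain ⟨-, T₀, hT₀⟩ := hC
  have h1 : limsup (fun T : ℝ => ((dirichletFun N v T : ℝ) : EReal)) atTop ≤ (C : EReal) := by
    refine limsup_le_of_le (by isBoundedDefault) ?_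
    filter_upwards [eventually_ge_atTop T₀, eventually_ge_atTop 0] with T hT hT0
    obtain ⟨q, hq, hqT, hle⟩ := hT₀ T hT v hv
    exact_mod_cast (dirichletFun_le N v hT0 hq hqT).trans hle
  have h2 : (0 : EReal) ≤ limsup (fun T : ℝ => ((dirichletFun N v T : ℝ) : EReal)) atTop := by
    refine le_limsup_of_frequently_le (Eventually.frequently ?_) (by isBoundedDefault)
    filter_upwards [eventually_ge_atTop 1] with T hT
    have := le_dirichletFun N v hT (r := 0) fun k _ _ => latticeDist_nonneg N _
    rw [mul_zero] at this
    exact_mod_cast this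
  rw [hlim] at h1 h2
  exact ⟨by exact_mod_cast h2, by exact_mod_cast h1⟩

lemma spectrum_ellipse {a c : ℝ} (ha : 0 < a) (hc : 0 < c)
    (hNu : ∀ u, N u = √(a * u 0 ^ 2 + c * u 1 ^ 2)) :
    IsLeast (dirichletConstants N) (ellipsoidValue a c 1) ∧
      dirichletSpectrum N = Icc 0 (ellipsoidValue a c 1) := by
  have hseg := hasBestEllipsoidSegment_ellipse ha hc hNu
  have hsub : Icc 0 (ellipsoidValue a c 1) ⊆ dirichletSpectrum N :=
    hseg.2.2.1.trans hseg.2.2.2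
  have hmem := ellipsoidValue_mem_dirichletConstants ha hc hNu (ellipse_definite ha hc hNu)
  exact ⟨⟨hmem, fun C hC => (dirichletSpectrum_subset_Icc hC
    (hsub ⟨(ellipsoidValue_pos ha hc le_rfl).le, le_rfl⟩)).2⟩,
    (dirichletSpectrum_subset_Icc hmem).antisymm hsub⟩

end UpperBound

theorem corollary1 :
    -- an arbitrary norm
    (∀ N : Seminorm ℝ (Fin 2 → ℝ), (∀ x, N x = 0 → x = 0) →
      ∃ M : ℝ, 0 < M ∧
        (∃ a c D : ℝ, IsBestEllipsoidNormFor N a c D) ∧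
        (∀ a c D : ℝ, IsBestEllipsoidNormFor N a c D → M = ellipsoidValue a c D) ∧
        Icc 0 M ⊆ limitingDirichletSpectrum N ∧
        limitingDirichletSpectrum N ⊆ dirichletSpectrum N) ∧
    -- a diagonal ellipse norm
    (∀ (N : Seminorm ℝ (Fin 2 → ℝ)) (a c : ℝ), 0 < a → 0 < c →
      (∀ u, N u = √(a * u 0 ^ 2 + c * u 1 ^ 2)) →
      ∃ M γ : ℝ, HasBestEllipsoidSegment N a c 1 M ∧
        (∀ M' : ℝ, Icc 0 M' ⊆ dirichletSpectrum N → M' ≤ M) ∧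
        IsLeast (dirichletConstants N) γ ∧ M = γ ∧
        dirichletSpectrum N = Icc 0 γ) ∧
    -- the table: Euclidean norm, maximum norm, `p`-norms
    (∀ N : Seminorm ℝ (Fin 2 → ℝ), (∀ u, N u = √(u 0 ^ 2 + u 1 ^ 2)) →
      HasBestEllipsoidSegment N 1 1 1 (√(2 / √3))) ∧
    (∀ N : Seminorm ℝ (Fin 2 → ℝ), (∀ u, N u = max |u 0| |u 1|) →
      HasBestEllipsoidSegment N (1 / 2) (1 / 2) (√2) ((7 : ℝ) ^ (-1 / 4 : ℝ))) ∧
    (∀ (N : Seminorm ℝ (Fin 2 → ℝ)) (p : ℝ), 2 < p →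
      (∀ u, N u = (|u 0| ^ p + |u 1| ^ p) ^ (1 / p)) →
      HasBestEllipsoidSegment N ((2 : ℝ) ^ (2 / p - 1)) ((2 : ℝ) ^ (2 / p - 1))
        ((2 : ℝ) ^ (1 / 2 - 1 / p))
        ((8 : ℝ) ^ (1 / (2 * p)) * (8 - (4 : ℝ) ^ (1 / p)) ^ (-1 / 4 : ℝ))) ∧
    (∀ (N : Seminorm ℝ (Fin 2 → ℝ)) (p : ℝ), 1 ≤ p → p < 2 →
      (∀ u, N u = (|u 0| ^ p + |u 1| ^ p) ^ (1 / p)) →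
      HasBestEllipsoidSegment N 1 1 ((2 : ℝ) ^ (1 / p - 1 / 2))
        (√2 * ((2 : ℝ) ^ (1 + 2 / p) - 1) ^ (-1 / 4 : ℝ))) := by
  refine ⟨fun N hN => ?_, fun N a c ha hc hNu => ?_, fun N hNu => ?_, fun N hNu => ?_,
    fun N p hp hNu => ?_, fun N p hp1 hp hNu => ?_⟩
  · obtain ⟨a, c, D, h⟩ := exists_isBestEllipsoidNormFor hN
    refine ⟨ellipsoidValue a c D, ellipsoidValue_pos h.1.1 h.1.2.1 h.1.2.2.1, ⟨a, c, D, h⟩,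
      fun a' c' D' h' => le_antisymm (h'.2 a c D h.1) (h.2 a' c' D' h'.1),
      Icc_subset_limitingDirichletSpectrum hN h.1, limitingDirichletSpectrum_subset N⟩
  · obtain ⟨hleast, hspec⟩ := spectrum_ellipse ha hc hNu
    refine ⟨_, _, hasBestEllipsoidSegment_ellipse ha hc hNu, fun M' hM' => ?_, hleast, rfl, hspec⟩
    rcases le_or_gt 0 M' with h0 | h0
    · exact (hspec ▸ hM' ⟨h0, le_rfl⟩ : M' ∈ Icc 0 (ellipsoidValue a c 1)).2
    · exact h0.le.trans (ellipsoidValue_pos ha hc le_rfl).le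
  · exact hasBestEllipsoidSegment_euclidean hNu
  · exact hasBestEllipsoidSegment_max hNu
  · exact hasBestEllipsoidSegment_pnorm_of_two_lt hp hNu
  · exact hasBestEllipsoidSegment_pnorm_of_lt_two hp1 hp hNu
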